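/- Let $\mathbb U\subset\mathbb C$ be an open set conformally equivalent to the unit disc $\mathbb D$ and let $\Sigma$ be a complex Banach space. Let $A^\infty$ be the Fréchet algebra of the functions $\sum_n c_nw^n$ on $\mathbb D$ with $(c_n)$ rapidly decreasing, topologized by the norms $|c|_k=\sup_n|c_n|(n+1)^k$, and let $A^\infty_{\mathbb U}=\{a\circ\varphi: a\in A^\infty\}$ for any conformal equivalence $\varphi:\mathbb U\to\mathbb D$ (the choice is immaterial). A Banach space $\mathscr F$ of analytic functions $\mathbb U\to\Sigma$ is called acceptable if (a) the evaluations $\delta_z:\mathscr F\to\Sigma$ ($z\in\mathbb U$) are continuous; (b) pointwise multiplication is a jointly continuous map $A^\infty_{\mathbb U}\times\mathscr F\to\mathscr F$; (c) for every conformal equivalence $\varphi:\mathbb U\to\mathbb D$ there is a constant $K[\varphi]$ such that, for $f:\mathbb U\to\Sigma$ analytic, $\varphi f\in\mathscr F$ if and only if $f\in\mathscr F$, and then $K[\varphi]^{-1}\|\varphi f\|\le\|f\|\le K[\varphi]\|\varphi f\|$. For a space $\mathscr F$ of analytic functions, write $\tau_{(n,0]}f=\big(\tfrac{f^{(n-1)}}{(n-1)!},\dots,f',f\big)$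 and $\tau_{[n,1]}f=\big(\tfrac{f^{(n)}}{n!},\dots,f'\big)$. For $z\in\mathbb U$ and $n\ge 0$ the Rochberg space is $\mathscr F^{(n)}_z=\{\tau_{(n,0]}f(z): f\in\mathscr F\}\subset\Sigma^n$ with the quotient norm $\|w\|=\inf\{\|f\|:\tau_{(n,0]}f(z)=w\}$ (so $\mathscr F^{(0)}_z=0$). Let $\mathscr F$ be acceptable, let $m\ge 1$, and fix a conformal equivalence $\psi:\mathbb D\to\mathbb U$. Put $\mathscr G=\{f\circ\psi:f\in\mathscr F\}$ with $\|f\circ\psi\|=\|f\|$; let $\mathscr G^{(1)}=\mathscr G$ and let $\mathscr G^{(n+1)}$ be the space of the arrays $(g_n,\dots,g_1,g)$ of analytic functions on $\mathbb D$ with $g\in\mathscr G$ and $(g_n,\dots,g_1)-\tau_{[n,1]}g\in\mathscr G^{(n)}$, normed by $\|(g_n,\dots,g_1)-\tau_{[n,1]}g\|_{\mathscr G^{(n)}}+\|g\|_{\mathscr G}$. For $w\in\mathbb D$ let $L(w)$ be the invertible $m\times m$ (Faà di Bruno) matrix such that $\tau_{(m,0]}(f\circ\psi)(w)=L(w)\,\tau_{(m,0]}f(\psi(w))$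 for all analytic $f$ on $\mathbb U$. Let $\mathscr T$ be the space of the functions $u\mapsto L(\psi^{-1}(u))^{-1}G(\psi^{-1}(u))$ from $\mathbb U$ to $\Sigma^m$, with $G\in\mathscr G^{(m)}$, normed by $\|G\|_{\mathscr G^{(m)}}$. Put $F[m,2]=\mathscr T^{(2)}_z$. Proposition. For each $m\ge 1$, each such $\psi$ and each $z\in\mathbb U$: for every $f\in\mathscr F$ the array $\tau_{(m,0]}f$ belongs to $\mathscr T$ and has there the norm $\|f\|_{\mathscr F}$; the map $E_{m,2}:\mathscr F^{(m+1)}_z\to F[m,2]$ that sends $\tau_{(m+1,0]}f(z)$ to $\tau_{(2,0]}(\tau_{(m,0]}f)(z)$, that is, $$E_{m,2}(x_m,\dots,x_0)=\Big(\tbinom{i+j}{i}x_{i+j}\Big)_{2>i\ge0,\ m>j\ge0},$$ is a well-defined bounded operator; it is an embedding (an isomorphism onto a closed subspace) with complemented range, and the quotient $F[m,2]/E_{m,2}[\mathscr F^{(m+1)}_z]$ is isomorphic to $\mathscr F^{(m-1)}_z$. Hence $F[m,2]\simeq\mathscr F^{(m+1)}_z\oplus\mathscr F^{(m-1)}_z$.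 -/

import Mathlib

open TopologicalSpace

noncomputable section

/-- The open unit disc. -/
def unitDisc : Opens ℂ := ⟨Metric.ball 0 1, Metric.isOpen_ball⟩

/-- A conformal equivalence (biholomorphic map) between two open subsets of the plane.
The values of `toFun` outside `U` and of `invFun` outside `V` are irrelevant. -/
structure ConformalEquiv (U V : Opens ℂ) where
  toFun : ℂ → ℂ
  invFun : ℂ → ℂ
  map_mem : ∀ u ∈ U, toFun u ∈ V
  inv_mem : ∀ v ∈ V, invFun v ∈ U
  left_inv : ∀ u ∈ U, invFun (toFun u) = u
  right_inv : ∀ v ∈ V, toFun (invFun v) = v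
  differentiableOn_toFun : DifferentiableOn ℂ toFun U
  differentiableOn_invFun : DifferentiableOn ℂ invFun V

/-- The Taylor coefficient `f⁽ᵏ⁾(z) / k!`. -/
def taylorCoeff {S : Type*} [NormedAddCommGroup S] [NormedSpace ℂ S]
    (k : ℕ) (f : ℂ → S) (z : ℂ) : S :=
  ((k.factorial : ℂ))⁻¹ • iteratedDeriv k f z

/-- A normed space of analytic functions `U → S`: a complex normed space `carrier` together with a
linear injective realization of its elements as analytic functions on `U` (functions are compared
on `U` only; the values outside `U` are irrelevant). -/
structure AnalyticSpace.{v, u} (U : Opens ℂ) (S : Type u)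
    [NormedAddCommGroup S] [NormedSpace ℂ S] where
  carrier : Type v
  [normedAddCommGroup : NormedAddCommGroup carrier]
  [normedSpace : NormedSpace ℂ carrier]
  toFun : carrier → ℂ → S
  map_add : ∀ f g : carrier, ∀ u ∈ U, toFun (f + g) u = toFun f u + toFun g u
  map_smul : ∀ (c : ℂ) (f : carrier), ∀ u ∈ U, toFun (c • f) u = c • toFun f u
  injective : ∀ f g : carrier, (∀ u ∈ U, toFun f u = toFun g u) → f = g
  analytic : ∀ f : carrier, AnalyticOnNhd ℂ (toFun f) U

attribute [instance] AnalyticSpace.normedAddCommGroup AnalyticSpace.normedSpace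

/-- Rapidly decreasing sequences of complex numbers. -/
def RapidlyDecreasing (c : ℕ → ℂ) : Prop :=
  ∀ k : ℕ, BddAbove (Set.range fun n : ℕ => ‖c n‖ * ((n : ℝ) + 1) ^ k)

/-- The increasing sequence of norms `|c|ₖ = supₙ |cₙ| (n + 1)ᵏ` that generates the Fréchet
topology of the space of rapidly decreasing sequences. -/
def rapidNorm (k : ℕ) (c : ℕ → ℂ) : ℝ := ⨆ n : ℕ, ‖c n‖ * ((n : ℝ) + 1) ^ k

namespace AnalyticSpace

section

variable {U V : Opens ℂ} {S : Type*} [NormedAddCommGroup S] [NormedSpace ℂ S]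

/-- Acceptable spaces of analytic functions on `U` (a domain conformally equivalent to the disc).

The algebra `A^∞` consists of the functions `∑ cₙ wⁿ` on the disc with `(cₙ)` rapidly decreasing,
with the Fréchet topology given by the norms `rapidNorm k`, and `A^∞_U = {a ∘ φ : a ∈ A^∞}` with
the transported topology, for any conformal `φ : U → 𝔻` (the algebra and its topology do not depend
on `φ`).  Joint continuity of the bilinear product `A^∞_U × X → X` is the estimate
`‖a f‖ ≤ C |a|ₖ ‖f‖` for some of the (increasing) norms and some constant. -/
structure IsAcceptable (X : AnalyticSpace U S) : Prop where
  complete : CompleteSpace X.carrier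
  continuous_eval : ∀ u ∈ U, Continuous fun f : X.carrier => X.toFun f u
  module : ∀ φ : ConformalEquiv U unitDisc, ∃ (k : ℕ) (C : ℝ),
    ∀ c : ℕ → ℂ, RapidlyDecreasing c → ∀ f : X.carrier, ∃ g : X.carrier,
      (∀ u ∈ U, X.toFun g u = (∑' n : ℕ, c n * φ.toFun u ^ n) • X.toFun f u) ∧
      ‖g‖ ≤ C * rapidNorm k c * ‖f‖
  conformal : ∀ φ : ConformalEquiv U unitDisc, ∃ K : ℝ, 0 < K ∧
    (∀ h : ℂ → S, AnalyticOnNhd ℂ h U →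
      ((∃ g : X.carrier, ∀ u ∈ U, X.toFun g u = φ.toFun u • h u) ↔
        (∃ f : X.carrier, ∀ u ∈ U, X.toFun f u = h u))) ∧
    (∀ f g : X.carrier, (∀ u ∈ U, X.toFun g u = φ.toFun u • X.toFun f u) →
      K⁻¹ * ‖g‖ ≤ ‖f‖ ∧ ‖f‖ ≤ K * ‖g‖)

end

section

variable {U V : Opens ℂ} {S : Type*} [NormedAddCommGroup S] [NormedSpace ℂ S] [CompleteSpace S]

theorem _root_.taylorCoeff_add (k : ℕ) {f g h : ℂ → S} (hf : AnalyticOnNhd ℂ f U)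
    (hg : AnalyticOnNhd ℂ g U) (hh : ∀ u ∈ U, h u = f u + g u) {z : ℂ} (hz : z ∈ U) :
    taylorCoeff k h z = taylorCoeff k f z + taylorCoeff k g z := by
  have e : h =ᶠ[nhds z] f + g := by
    filter_upwards [U.isOpen.mem_nhds hz] with u hu using hh u hu
  rw [taylorCoeff, e.iteratedDeriv_eq, iteratedDeriv_add (hf z hz).contDiffAt (hg z hz).contDiffAt,
    smul_add]
  rfl

theorem _root_.taylorCoeff_smul (k : ℕ) {f h : ℂ → S} (c : ℂ)
    (hh : ∀ u ∈ U, h u = c • f u) {z : ℂ} (hz : z ∈ U) :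
    taylorCoeff k h z = c • taylorCoeff k f z := by
  have e : h =ᶠ[nhds z] c • f := by
    filter_upwards [U.isOpen.mem_nhds hz] with u hu using hh u hu
  rw [taylorCoeff, e.iteratedDeriv_eq, iteratedDeriv_const_smul_field, smul_comm]
  rfl

theorem _root_.taylorCoeff_analytic (k : ℕ) {f : ℂ → S} (hf : AnalyticOnNhd ℂ f U) :
    AnalyticOnNhd ℂ (taylorCoeff k f) U := by
  have h := hf.iterated_deriv k
  rw [← iteratedDeriv_eq_iterate] at h
  exact fun z hz => (analyticAt_const (v := ((k.factorial : ℂ))⁻¹)).smul (h z hz)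

/-- `X.jet n z f = τ_{(n,0]} f (z)`: the list of Taylor coefficients of `f` at `z` of orders `< n`.
The coordinate with index `i` is the coefficient of order `i`. -/
def jet (X : AnalyticSpace U S) (n : ℕ) (z : U) : X.carrier →ₗ[ℂ] (Fin n → S) where
  toFun f i := taylorCoeff i (X.toFun f) z
  map_add' f g := by
    ext i
    exact taylorCoeff_add _ (X.analytic f) (X.analytic g) (X.map_add f g) z.2
  map_smul' c f := by
    ext i
    exact taylorCoeff_smul _ c (X.map_smul c f) z.2

/-- The Rochberg space `X^{(n)}_z`: the `w ∈ Sⁿ` of the form `τ_{(n,0]} f (z)` with `f ∈ X`.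
(It carries the quotient norm below, not the norm of `Sⁿ`.) -/
def Rochberg (X : AnalyticSpace U S) (n : ℕ) (z : U) : Type _ :=
  ↥(LinearMap.range (X.jet n z))

namespace Rochberg

variable (X : AnalyticSpace U S) (n : ℕ) (z : U)

instance : AddCommGroup (X.Rochberg n z) :=
  inferInstanceAs (AddCommGroup ↥(LinearMap.range (X.jet n z)))

instance : Module ℂ (X.Rochberg n z) :=
  inferInstanceAs (Module ℂ ↥(LinearMap.range (X.jet n z)))

/-- The inclusion `X^{(n)}_z ⊆ Sⁿ`. -/
def val : X.Rochberg n z →ₗ[ℂ] (Fin n → S) := (LinearMap.range (X.jet n z)).subtype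

/-- The quotient map `f ↦ τ_{(n,0]} f (z)` from `X` onto `X^{(n)}_z`. -/
def mk : X.carrier →ₗ[ℂ] X.Rochberg n z := (X.jet n z).rangeRestrict

/-- The quotient norm: the infimum of the norms of the functions representing `w`. -/
instance : Norm (X.Rochberg n z) :=
  ⟨fun w => sInf {r : ℝ | ∃ f : X.carrier, X.jet n z f = val X n z w ∧ ‖f‖ = r}⟩

theorem norm_def (w : X.Rochberg n z) :
    ‖w‖ = sInf {r : ℝ | ∃ f : X.carrier, X.jet n z f = val X n z w ∧ ‖f‖ = r} := rfl

theorem norm_le {w : X.Rochberg n z} {f : X.carrier} (h : X.jet n z f = val X n z w) :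
    ‖w‖ ≤ ‖f‖ :=
  csInf_le ⟨0, by rintro _ ⟨g, -, rfl⟩; exact norm_nonneg g⟩ ⟨f, h, rfl⟩

theorem exists_norm_lt (w : X.Rochberg n z) {e : ℝ} (he : 0 < e) :
    ∃ f : X.carrier, X.jet n z f = val X n z w ∧ ‖f‖ < ‖w‖ + e := by
  obtain ⟨f₀, hf₀⟩ := LinearMap.mem_range.1 w.2
  obtain ⟨_, ⟨f, hf, rfl⟩, h⟩ := exists_lt_of_csInf_lt
    (s := {r : ℝ | ∃ f : X.carrier, X.jet n z f = val X n z w ∧ ‖f‖ = r})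
    ⟨_, f₀, hf₀, rfl⟩ (lt_add_of_pos_right _ he)
  exact ⟨f, hf, h⟩

theorem norm_nonneg' (w : X.Rochberg n z) : 0 ≤ ‖w‖ :=
  Real.sInf_nonneg (by rintro _ ⟨f, -, rfl⟩; exact norm_nonneg f)

theorem norm_smul_le' (c : ℂ) (w : X.Rochberg n z) : ‖c • w‖ ≤ ‖c‖ * ‖w‖ := by
  refine le_of_forall_pos_le_add fun e he => ?_
  obtain ⟨f, hf, h⟩ := exists_norm_lt X n z w (e := e / (‖c‖ + 1)) (by positivity)
  have h1 : ‖c • w‖ ≤ ‖c • f‖ := norm_le X n z (by rw [_root_.map_smul, _root_.map_smul, hf])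
  have h2 : ‖c‖ * (e / (‖c‖ + 1)) ≤ e := by
    rw [← mul_div_assoc, div_le_iff₀ (by positivity)]
    nlinarith [norm_nonneg c]
  rw [_root_.norm_smul c f] at h1
  nlinarith [mul_le_mul_of_nonneg_left h.le (norm_nonneg c)]

/-- The quotient seminorm satisfies the axioms of a seminorm (it is a norm as soon as the
evaluations are continuous on a complete `X`). -/
theorem core : SeminormedSpace.Core ℂ (X.Rochberg n z) where
  norm_nonneg := norm_nonneg' X n z
  norm_smul c w := by
    refine le_antisymm (norm_smul_le' X n z c w) ?_
    by_cases hc : c = 0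
    · subst hc; simpa using norm_nonneg' X n z ((0 : ℂ) • w)
    · have h := norm_smul_le' X n z c⁻¹ (c • w)
      rw [inv_smul_smul₀ hc, norm_inv] at h
      have hc' : 0 < ‖c‖ := norm_pos_iff.2 hc
      rwa [← div_eq_inv_mul, le_div_iff₀ hc', mul_comm] at h
  norm_triangle v w := by
    refine le_of_forall_pos_le_add fun e he => ?_
    obtain ⟨f, hf, h1⟩ := exists_norm_lt X n z v (half_pos he)
    obtain ⟨g, hg, h2⟩ := exists_norm_lt X n z w (half_pos he)
    have h3 : ‖v + w‖ ≤ ‖f + g‖ :=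
      norm_le X n z (by rw [_root_.map_add, _root_.map_add, hf, hg])
    linarith [norm_add_le f g]

instance : SeminormedAddCommGroup (X.Rochberg n z) :=
  SeminormedAddCommGroup.ofCore (core X n z)

instance : NormedSpace ℂ (X.Rochberg n z) where
  norm_smul_le c w := ((core X n z).norm_smul c w).le

end Rochberg

/-- The change of variable `ψ^*[X] = {f ∘ ψ : f ∈ X}` with `‖f ∘ ψ‖ = ‖f‖`. -/
def pullback (X : AnalyticSpace U S) (ψ : ConformalEquiv V U) : AnalyticSpace V S where
  carrier := X.carrier
  toFun f w := X.toFun f (ψ.toFun w)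
  map_add f g w hw := X.map_add f g _ (ψ.map_mem w hw)
  map_smul c f w hw := X.map_smul c f _ (ψ.map_mem w hw)
  injective f g h := X.injective f g fun u hu => by
    have := h (ψ.invFun u) (ψ.inv_mem u hu)
    simpa only [ψ.right_inv u hu] using this
  analytic f := (X.analytic f).comp (ψ.differentiableOn_toFun.analyticOnNhd V.isOpen)
    (fun w hw => ψ.map_mem w hw)

/-- The space of functions with values in `S⁰ = 0`. -/
def zeroSpace.{v, u} (U : Opens ℂ) (S : Type u) [NormedAddCommGroup S] [NormedSpace ℂ S] :
    AnalyticSpace.{v, u} U (Fin 0 → S) where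
  carrier := PUnit.{v + 1}
  toFun _ _ := 0
  map_add _ _ _ _ := (add_zero _).symm
  map_smul _ _ _ _ := (smul_zero _).symm
  injective _ _ _ := rfl
  analytic _ := analyticOnNhd_const

/-- The twisted sum `Y ⊕_{τ_{[n,1]}} X`, that is, the space of the tuples of analytic functions
`(fₙ, …, f₁, f)` such that `f ∈ X` and `(fₙ, …, f₁) - τ_{[n,1]} f ∈ Y`, with the norm
`‖(fₙ, …, f₁) - τ_{[n,1]} f‖_Y + ‖f‖_X`.  The tuple `(fₙ, …, f₁, f)` is encoded by the pair
`((fₙ, …, f₁) - τ_{[n,1]} f, f)` of `Y × X`, with the `ℓ¹` norm; see `twist_mem_iff` and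
`twist_norm`.  The component with index `0` is `f`, and the one with index `i + 1` is `f_{i+1}`. -/
def twist.{v, u} {S : Type u} [NormedAddCommGroup S] [NormedSpace ℂ S] [CompleteSpace S] {n : ℕ}
    (Y : AnalyticSpace.{v, u} U (Fin n → S)) (X : AnalyticSpace.{v, u} U S) :
    AnalyticSpace.{v, u} U (Fin (n + 1) → S) where
  carrier := WithLp 1 (Y.carrier × X.carrier)
  toFun p w := Fin.cons (X.toFun p.snd w)
    (fun i : Fin n => Y.toFun p.fst w i + taylorCoeff (i + 1) (X.toFun p.snd) w)
  map_add p q w hw := by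
    ext i
    refine Fin.cases ?_ (fun i => ?_) i
    · exact X.map_add _ _ w hw
    · have h := taylorCoeff_add (i + 1) (X.analytic p.snd) (X.analytic q.snd)
        (X.map_add p.snd q.snd) hw
      have h' := congrFun (Y.map_add p.fst q.fst w hw) i
      simp only [Fin.cons_succ, Pi.add_apply, WithLp.add_fst, WithLp.add_snd] at h h' ⊢
      rw [h, h']
      abel
  map_smul c p w hw := by
    ext i
    refine Fin.cases ?_ (fun i => ?_) i
    · exact X.map_smul _ _ w hw
    · have h := taylorCoeff_smul (i + 1) c (X.map_smul c p.snd) hw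
      have h' := congrFun (Y.map_smul c p.fst w hw) i
      simp only [Fin.cons_succ, Pi.smul_apply, WithLp.smul_fst, WithLp.smul_snd] at h h' ⊢
      rw [h, h', smul_add]
  injective p q h := by
    have h1 : p.snd = q.snd := X.injective _ _ fun w hw => by
      simpa using congrFun (h w hw) 0
    have h2 : p.fst = q.fst := Y.injective _ _ fun w hw => by
      ext i
      have := congrFun (h w hw) i.succ
      simpa [h1] using this
    exact WithLp.ofLp_injective 1 (Prod.ext h2 h1)
  analytic p := by
    intro w hw
    rw [analyticAt_pi_iff]
    intro i
    refine Fin.cases ?_ (fun i => ?_) i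
    · exact X.analytic _ w hw
    · exact (analyticAt_pi_iff.1 (Y.analytic p.fst w hw) i).add
        (taylorCoeff_analytic _ (X.analytic p.snd) w hw)

theorem twist_mem_iff.{v, u} {S : Type u} [NormedAddCommGroup S] [NormedSpace ℂ S]
    [CompleteSpace S] {n : ℕ}
    (Y : AnalyticSpace.{v, u} U (Fin n → S)) (X : AnalyticSpace.{v, u} U S)
    (h : ℂ → Fin (n + 1) → S) :
    (∃ p : (Y.twist X).carrier, ∀ w ∈ U, (Y.twist X).toFun p w = h w) ↔
      ∃ f : X.carrier, (∀ w ∈ U, X.toFun f w = h w 0) ∧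
        ∃ g : Y.carrier, ∀ w ∈ U, Y.toFun g w =
          fun i : Fin n => h w i.succ - taylorCoeff (i + 1) (X.toFun f) w := by
  constructor
  · rintro ⟨p, hp⟩
    refine ⟨p.snd, fun w hw => ?_, p.fst, fun w hw => ?_⟩
    · rw [← hp w hw]; rfl
    · ext i; rw [← hp w hw]; exact (add_sub_cancel_right _ _).symm
  · rintro ⟨f, hf, g, hg⟩
    refine ⟨WithLp.toLp 1 (g, f), fun w hw => ?_⟩
    ext i
    refine Fin.cases ?_ (fun i => ?_) i
    · exact hf w hw
    · exact (congrArg (· + taylorCoeff (i + 1) (X.toFun f) w) (congrFun (hg w hw) i)).trans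
        (sub_add_cancel _ _)

theorem twist_norm.{v, u} {S : Type u} [NormedAddCommGroup S] [NormedSpace ℂ S]
    [CompleteSpace S] {n : ℕ}
    (Y : AnalyticSpace.{v, u} U (Fin n → S)) (X : AnalyticSpace.{v, u} U S)
    (p : WithLp 1 (Y.carrier × X.carrier)) :
    ‖(show (Y.twist X).carrier from p)‖ = ‖p.fst‖ + ‖p.snd‖ :=
  WithLp.prod_norm_eq_of_L1 p

/-- The spaces `X^{(n)}` of `Sⁿ`-valued analytic functions: `X^{(n+1)} = X^{(n)} ⊕_{τ_{[n,1]}} X`.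
Starting with `X^{(0)} = 0` gives `X^{(1)} = X`. -/
def family.{v, u} {S : Type u} [NormedAddCommGroup S] [NormedSpace ℂ S] [CompleteSpace S]
    (X : AnalyticSpace.{v, u} U S) : (n : ℕ) → AnalyticSpace.{v, u} U (Fin n → S)
  | 0 => zeroSpace U S
  | n + 1 => (family X n).twist X

end

end AnalyticSpace

namespace ConformalEquiv

variable {U V : Opens ℂ}

/-- The inverse conformal equivalence. -/
def symm (ψ : ConformalEquiv V U) : ConformalEquiv U V where
  toFun := ψ.invFun
  invFun := ψ.toFun
  map_mem := ψ.inv_mem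
  inv_mem := ψ.map_mem
  left_inv := ψ.right_inv
  right_inv := ψ.left_inv
  differentiableOn_toFun := ψ.differentiableOn_invFun
  differentiableOn_invFun := ψ.differentiableOn_toFun

/-- The Taylor series of `w ↦ ψ w - ψ z` about `z`. -/
def series (ψ : ConformalEquiv V U) (z : ℂ) : PowerSeries ℂ :=
  PowerSeries.mk fun k => if k = 0 then 0 else taylorCoeff k ψ.toFun z

/-- The Faà di Bruno matrix of `ψ` at `z`.  If `f(v) = ∑ xⱼ (v - ψ z)ʲ` near `ψ z`, then
`f(ψ(w)) = ∑ xⱼ (ψ w - ψ z)ʲ` near `z`, so the Taylor coefficients of `f ∘ ψ` at `z` are obtained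
from those of `f` at `ψ z` through the matrix with entries `[(w - z)ⁱ] (ψ w - ψ z)ʲ`. -/
def faaDiBruno (ψ : ConformalEquiv V U) (n : ℕ) (z : ℂ) : Matrix (Fin n) (Fin n) ℂ :=
  Matrix.of fun i j => PowerSeries.coeff (i : ℕ) (ψ.series z ^ (j : ℕ))

theorem deriv_ne_zero (ψ : ConformalEquiv V U) {z : ℂ} (hz : z ∈ V) : deriv ψ.toFun z ≠ 0 := by
  have h1 : HasDerivAt ψ.toFun (deriv ψ.toFun z) z :=
    (ψ.differentiableOn_toFun.differentiableAt (V.isOpen.mem_nhds hz)).hasDerivAt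
  have h2 : HasDerivAt ψ.invFun (deriv ψ.invFun (ψ.toFun z)) (ψ.toFun z) :=
    (ψ.differentiableOn_invFun.differentiableAt
      (U.isOpen.mem_nhds (ψ.map_mem z hz))).hasDerivAt
  have h3 := h2.comp z h1
  have h4 : HasDerivAt (ψ.invFun ∘ ψ.toFun) 1 z :=
    (hasDerivAt_id z).congr_of_eventuallyEq (by
      filter_upwards [V.isOpen.mem_nhds hz] with w hw using ψ.left_inv w hw)
  intro h
  rw [h, mul_zero] at h3
  exact zero_ne_one (h3.unique h4)

theorem series_eq (ψ : ConformalEquiv V U) (z : ℂ) :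
    ∃ q : PowerSeries ℂ, ψ.series z = PowerSeries.X * q ∧
      PowerSeries.coeff 0 q = deriv ψ.toFun z := by
  obtain ⟨q, hq⟩ : PowerSeries.X ∣ ψ.series z := by
    rw [PowerSeries.X_dvd_iff, ← PowerSeries.coeff_zero_eq_constantCoeff_apply]
    simp [series]
  refine ⟨q, hq, ?_⟩
  have := congrArg (PowerSeries.coeff 1) hq
  rw [show (1 : ℕ) = 0 + 1 from rfl, PowerSeries.coeff_succ_X_mul] at this
  rw [← this]
  simp [series, taylorCoeff]

theorem det_faaDiBruno_ne_zero (ψ : ConformalEquiv V U) (n : ℕ) {z : ℂ} (hz : z ∈ V) :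
    (ψ.faaDiBruno n z).det ≠ 0 := by
  obtain ⟨q, hq, hq0⟩ := ψ.series_eq z
  have hlow : (ψ.faaDiBruno n z).IsLowerTriangular := by
    intro i j hij
    have hij' : (i : ℕ) < j := hij
    simp only [faaDiBruno, Matrix.of_apply]
    rw [hq, mul_pow, PowerSeries.coeff_X_pow_mul', if_neg (by omega)]
  rw [Matrix.det_of_isLowerTriangular _ hlow, Finset.prod_ne_zero_iff]
  intro i _
  simp only [faaDiBruno, Matrix.of_apply]
  rw [hq, mul_pow, PowerSeries.coeff_X_pow_mul', if_pos le_rfl, Nat.sub_self,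
    PowerSeries.coeff_zero_eq_constantCoeff_apply, map_pow,
    ← PowerSeries.coeff_zero_eq_constantCoeff_apply, hq0]
  exact pow_ne_zero _ (ψ.deriv_ne_zero hz)

theorem faaDiBruno_analytic (ψ : ConformalEquiv V U) (n : ℕ) (i j : Fin n) :
    AnalyticOnNhd ℂ (fun z => ψ.faaDiBruno n z i j) V := by
  simp only [faaDiBruno, Matrix.of_apply]
  generalize (i : ℕ) = a
  induction (j : ℕ) generalizing a with
  | zero => simpa using analyticOnNhd_const
  | succ b ih =>
    simp only [pow_succ, PowerSeries.coeff_mul]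
    refine Finset.analyticOnNhd_fun_sum _ fun p _ => (ih p.1).mul ?_
    simp only [series, PowerSeries.coeff_mk]
    split_ifs
    · exact analyticOnNhd_const
    · exact taylorCoeff_analytic _ (ψ.differentiableOn_toFun.analyticOnNhd V.isOpen)

theorem _root_.analyticOnNhd_det {ι : Type*} [Fintype ι] [DecidableEq ι] {s : Set ℂ}
    {A : ℂ → Matrix ι ι ℂ} (h : ∀ i j, AnalyticOnNhd ℂ (fun z => A z i j) s) :
    AnalyticOnNhd ℂ (fun z => (A z).det) s := by
  simp only [Matrix.det_apply']
  exact Finset.analyticOnNhd_fun_sum _ fun σ _ =>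
    analyticOnNhd_const.mul (Finset.analyticOnNhd_fun_prod _ fun i _ => h _ _)

theorem _root_.analyticOnNhd_matrix_inv {ι : Type*} [Fintype ι] [DecidableEq ι] {s : Set ℂ}
    {A : ℂ → Matrix ι ι ℂ} (h : ∀ i j, AnalyticOnNhd ℂ (fun z => A z i j) s)
    (h0 : ∀ z ∈ s, (A z).det ≠ 0) (i j : ι) :
    AnalyticOnNhd ℂ (fun z => (A z)⁻¹ i j) s := by
  simp only [Matrix.inv_def, Matrix.smul_apply, Ring.inverse_eq_inv', Matrix.adjugate_apply,
    smul_eq_mul]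
  refine ((analyticOnNhd_det h).inv h0).mul (analyticOnNhd_det fun k l => ?_)
  by_cases hk : k = j
  · subst hk; simpa using analyticOnNhd_const
  · simpa [Matrix.updateRow_apply, hk] using h k l

end ConformalEquiv

namespace AnalyticSpace

section

variable {U : Opens ℂ}

/-- The space `𝒯` of `Sⁿ`-valued analytic functions on `U` attached to `X` and to a conformal map
`ψ : 𝔻 → U`.  With `𝒢 = ψ^*[X]` and `L(z)` the Faà di Bruno matrix of `ψ` at `z ∈ 𝔻` (so that
`τ_{(n,0]}(f ∘ ψ)(z) = L(z) τ_{(n,0]} f(ψ z)`), it consists of the functions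
`u ↦ L(ψ⁻¹ u)⁻¹ (G (ψ⁻¹ u))` with `G ∈ 𝒢^{(n)}`, with the norm of `G`. -/
def rochbergFamily.{v, u} {S : Type u} [NormedAddCommGroup S] [NormedSpace ℂ S] [CompleteSpace S]
    (X : AnalyticSpace.{v, u} U S) (ψ : ConformalEquiv unitDisc U) (n : ℕ) :
    AnalyticSpace.{v, u} U (Fin n → S) where
  carrier := ((X.pullback ψ).family n).carrier
  toFun G u i := ∑ j, (ψ.faaDiBruno n (ψ.invFun u))⁻¹ i j •
    ((X.pullback ψ).family n).toFun G (ψ.invFun u) j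
  map_add G H u hu := by
    ext i
    simp only [map_add _ G H _ (ψ.inv_mem u hu), Pi.add_apply, smul_add, Finset.sum_add_distrib]
  map_smul c G u hu := by
    ext i
    simp only [map_smul _ c G _ (ψ.inv_mem u hu), Pi.smul_apply, Finset.smul_sum]
    exact Finset.sum_congr rfl fun j _ => smul_comm _ _ _
  injective G H h := by
    refine injective _ G H fun w hw => ?_
    have h1 := h (ψ.toFun w) (ψ.map_mem w hw)
    simp only [ψ.left_inv w hw] at h1
    set A := ψ.faaDiBruno n w
    have hA : A * A⁻¹ = 1 :=
      Matrix.mul_nonsing_inv A (isUnit_iff_ne_zero.2 (ψ.det_faaDiBruno_ne_zero n hw))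
    have key : ∀ x : Fin n → S, ∀ k, ∑ i, A k i • ∑ j, A⁻¹ i j • x j = x k := by
      intro x k
      simp only [Finset.smul_sum, smul_smul]
      rw [Finset.sum_comm]
      simp only [← Finset.sum_smul, ← Matrix.mul_apply, hA, Matrix.one_apply, ite_smul, one_smul,
        zero_smul, Finset.sum_ite_eq, Finset.mem_univ, if_true]
    ext k
    rw [← key (((X.pullback ψ).family n).toFun G w) k,
      ← key (((X.pullback ψ).family n).toFun H w) k]
    exact Finset.sum_congr rfl fun i _ => congrArg _ (congrFun h1 i)
  analytic G := by
    have hinv : AnalyticOnNhd ℂ ψ.invFun U := ψ.differentiableOn_invFun.analyticOnNhd U.isOpen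
    intro u hu
    rw [analyticAt_pi_iff]
    intro i
    refine Finset.analyticAt_fun_sum _ fun j _ => ?_
    have h1 : AnalyticAt ℂ (fun w => (ψ.faaDiBruno n w)⁻¹ i j) (ψ.invFun u) :=
      analyticOnNhd_matrix_inv (ψ.faaDiBruno_analytic n)
        (fun z hz => ψ.det_faaDiBruno_ne_zero n hz) i j _ (ψ.inv_mem u hu)
    have h2 := analyticAt_pi_iff.1
      (analytic ((X.pullback ψ).family n) G _ (ψ.inv_mem u hu)) j
    exact (h1.comp (hinv u hu)).smul (h2.comp (hinv u hu))

end

end AnalyticSpace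

end

universe u v

set_option linter.unusedSectionVars false

noncomputable section

/-! ### Calculus of Taylor coefficients. -/

section TaylorCalculus

variable {S : Type*} [NormedAddCommGroup S] [NormedSpace ℂ S] [CompleteSpace S]

/-! Composition with `ψ` or its inverse and multiplication by the analytic invertible matrices L
preserve the vanishing of jets, so everything can be computed on the disc at w = ψ⁻¹(z)
(`mk_pullback_eq_zero_iff`, `mk_rochbergFamily_eq_zero_iff`). Once the twisted sums are unrolled, an
element of 𝒢^{(m)} is a tuple g_0, …, g_{m-1} in 𝒢, extended by g_k = 0 for k ≥ m; its entry of
index i is the sum over a + b = i of the Taylor coefficients of order b of g_a (`family_toFun`).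
With ĝ_a(b) this coefficient at w, put s_i = ∑ ĝ_a(b) and t_i = ∑ b ĝ_a(b), over a + b = i. Then
τ_{(2,0]} at w determines, and is determined by, s_0, …, s_{m-1} and t_1, …, t_m
(`mk_family_eq_zero_iff`). The array τ_{(m,0]} f corresponds to (f, 0, …, 0).

Because a = i - b, every weight affine in a yields a combination of s_i and t_i. The weight 1 - a/m
yields (1 - i/m) s_i + t_i/m, which makes sense up to i = m, where the invisible s_m drops out.
These m + 1 values are the Taylor coefficients of R = ∑ (1 - k/m)(x - w)^k g_k, which induces a left
inverse of E. The weight a yields i s_i - t_i for 1 ≤ i < m, the m - 1 coefficients of Q = ∑ (k +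
1)(x - w)^k g_{k+1}, which vanishes on the range of E. The tuple J b = ((1/m - 1)(x - w) b, b, 0,
…), truncated to length m, is a section of Q, and E R + J Q is the identity on jets
(`mk_single_retraction_add`).

Acceptability enters twice: multiplication by x - w is bounded, and so are the Taylor coefficients,
which separates the points of the Rochberg spaces and makes the range of E, equal to the kernel of
Q, closed. -/

theorem taylorCoeff_zero (f : ℂ → S) (z : ℂ) : taylorCoeff 0 f z = f z := by
  simp [taylorCoeff]

theorem taylorCoeff_congr {f g : ℂ → S} {z : ℂ} (h : f =ᶠ[nhds z] g) (k : ℕ) :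
    taylorCoeff k f z = taylorCoeff k g z := by
  rw [taylorCoeff, taylorCoeff, h.iteratedDeriv_eq]

theorem taylorCoeff_smul_analyticAt {f : ℂ → ℂ} {g : ℂ → S} {z : ℂ} (hf : AnalyticAt ℂ f z)
    (hg : AnalyticAt ℂ g z) (k : ℕ) :
    taylorCoeff k (fun w => f w • g w) z =
      ∑ p ∈ Finset.HasAntidiagonal.antidiagonal k, taylorCoeff p.1 f z • taylorCoeff p.2 g z := by
  have h := iteratedDerivWithin_smul (n := k) (Set.mem_univ z) uniqueDiffOn_univ
    (hf.contDiffAt.contDiffWithinAt (s := Set.univ)) (hg.contDiffAt.contDiffWithinAt)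
  simp only [iteratedDerivWithin_univ] at h
  rw [taylorCoeff, show (fun w => f w • g w) = f • g from rfl, h,
    Finset.Nat.sum_antidiagonal_eq_sum_range_succ
      (fun i j => taylorCoeff i f z • taylorCoeff j g z), Finset.smul_sum]
  refine Finset.sum_congr rfl fun i hi => ?_
  have hik : i ≤ k := Nat.lt_succ_iff.1 (Finset.mem_range.1 hi)
  simp only [taylorCoeff, smul_eq_mul, ← Nat.cast_smul_eq_nsmul ℂ, smul_smul, mul_assoc]
  congr 1
  rw [Nat.cast_choose ℂ hik]
  have h0 : ((k.factorial : ℂ)) ≠ 0 := by exact_mod_cast k.factorial_ne_zero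
  field_simp

theorem taylorCoeff_sum_smul {ι : Type*} (s : Finset ι) {f : ι → ℂ → S} {z : ℂ} (c : ι → ℂ)
    (hf : ∀ i ∈ s, AnalyticAt ℂ (f i) z) (k : ℕ) :
    taylorCoeff k (fun w => ∑ i ∈ s, c i • f i w) z = ∑ i ∈ s, c i • taylorCoeff k (f i) z := by
  rw [taylorCoeff, iteratedDeriv_fun_sum fun i hi => ((hf i hi).contDiffAt.const_smul (c i)),
    Finset.smul_sum]
  refine Finset.sum_congr rfl fun i _ => ?_
  rw [iteratedDeriv_fun_const_smul_field, smul_comm, taylorCoeff]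

theorem taylorCoeff_const (k : ℕ) (x : S) (z : ℂ) :
    taylorCoeff k (fun _ => x) z = if k = 0 then x else 0 := by
  by_cases h : k = 0 <;> simp [taylorCoeff, iteratedDeriv_const, h]

theorem taylorCoeff_sub_const (k : ℕ) (a z : ℂ) :
    taylorCoeff k (fun w => w - a) z = if k = 0 then z - a else if k = 1 then 1 else 0 := by
  rcases k with _ | _ | k
  · simp [taylorCoeff]
  · simp [taylorCoeff, iteratedDeriv_succ']
  · simp [taylorCoeff, iteratedDeriv_succ']

/-- Multiplication by `w - z` shifts the Taylor coefficients at `z`. -/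
theorem taylorCoeff_succ_sub_smul {g : ℂ → S} {z : ℂ} (hg : AnalyticAt ℂ g z) (k : ℕ) :
    taylorCoeff (k + 1) (fun w => (w - z) • g w) z = taylorCoeff k g z := by
  rw [taylorCoeff_smul_analyticAt (f := fun w => w - z) (analyticAt_id.sub analyticAt_const) hg,
    Finset.sum_eq_single ((1, k) : ℕ × ℕ)]
  · simp [taylorCoeff_sub_const]
  · rintro ⟨i, j⟩ hij h
    have hij' : i + j = k + 1 := Finset.HasAntidiagonal.mem_antidiagonal.1 hij
    have : i ≠ 1 := fun hi => h (by subst hi; simp; omega)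
    by_cases h0 : i = 0 <;> simp [taylorCoeff_sub_const, this, h0]
  · intro h
    exact absurd (Finset.HasAntidiagonal.mem_antidiagonal.2 (by simp; omega)) h

/-- The source of the binomial factors in E. -/
theorem taylorCoeff_taylorCoeff (i j : ℕ) (f : ℂ → S) (z : ℂ) :
    taylorCoeff i (taylorCoeff j f) z = ((i + j).choose i : ℂ) • taylorCoeff (i + j) f z := by
  have h : iteratedDeriv i (iteratedDeriv j f) = iteratedDeriv (i + j) f := by
    simp only [iteratedDeriv_eq_iterate, Function.iterate_add_apply]
  rw [taylorCoeff, show taylorCoeff j f = ((j.factorial : ℂ)⁻¹) • iteratedDeriv j f from rfl,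
    iteratedDeriv_const_smul_field, h, taylorCoeff, smul_smul, smul_smul]
  congr 1
  rw [Nat.cast_add_choose]
  have h0 : (((i + j).factorial : ℂ)) ≠ 0 := by exact_mod_cast (i + j).factorial_ne_zero
  field_simp

theorem taylorCoeff_apply {ι : Type*} [Fintype ι] {f : ℂ → ι → S} {z : ℂ}
    (hf : AnalyticAt ℂ f z) (k : ℕ) (i : ι) :
    taylorCoeff k f z i = taylorCoeff k (fun w => f w i) z := by
  -- Equality on a neighbourhood, not just at `z`, is what survives the next derivative in the
  -- induction.
  have h : ∀ k : ℕ, ∀ᶠ w in nhds z, iteratedDeriv k (fun w => f w i) w = iteratedDeriv k f w i := by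
    intro k
    induction k with
    | zero => simp
    | succ k ih =>
      have han : ∀ᶠ w in nhds z, AnalyticAt ℂ f w := hf.eventually_analyticAt
      filter_upwards [ih.eventually_nhds, han] with w hw hfw
      rw [iteratedDeriv_succ, iteratedDeriv_succ, Filter.EventuallyEq.deriv_eq hw]
      have hd : DifferentiableAt ℂ (iteratedDeriv k f) w := by
        rw [iteratedDeriv_eq_iterate]
        exact (hfw.iterated_deriv k).differentiableAt
      have := hasDerivAt_pi.1 hd.hasDerivAt i
      exact this.deriv
  simp only [taylorCoeff, Pi.smul_apply, (h k).self_of_nhds]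

theorem analyticAt_dslope {f : ℂ → S} {a : ℂ} (hf : AnalyticAt ℂ f a) :
    AnalyticAt ℂ (dslope f a) a := by
  obtain ⟨p, hp⟩ := hf
  exact ⟨_, hp.has_fpower_series_dslope_fslope⟩

end TaylorCalculus

/-! ### The Faà di Bruno formula and invariance of vanishing jets. -/

namespace ConformalEquiv

variable {U V : Opens ℂ} {S : Type*} [NormedAddCommGroup S] [NormedSpace ℂ S] [CompleteSpace S]

theorem analyticAt (ψ : ConformalEquiv V U) {w : ℂ} (hw : w ∈ V) : AnalyticAt ℂ ψ.toFun w :=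
  ψ.differentiableOn_toFun.analyticOnNhd V.isOpen w hw

/-- The Faà di Bruno formula. -/
theorem taylorCoeff_comp (ψ : ConformalEquiv V U) {w : ℂ} (hw : w ∈ V) {f : ℂ → S}
    (hf : AnalyticAt ℂ f (ψ.toFun w)) {n i : ℕ} (hi : i < n) :
    taylorCoeff i (fun x => f (ψ.toFun x)) w =
      ∑ j ∈ Finset.range n, PowerSeries.coeff i (ψ.series w ^ j) •
        taylorCoeff j f (ψ.toFun w) := by
  induction n generalizing f i with
  | zero => omega
  | succ n ih =>
    set a := ψ.toFun w with ha
    set g := dslope f a with hg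
    have hga : AnalyticAt ℂ g a := analyticAt_dslope hf
    have hψ := ψ.analyticAt hw
    -- Peeling off f(a) leaves one factor v - a, so the coefficients of `g` are those of `f` moved
    -- down by one; this drives the induction on `n`.
    have hfg : f = fun v => f a + (v - a) • g v := by
      funext v; rw [hg, sub_smul_dslope]; abel
    have hgψ : AnalyticAt ℂ (fun x => g (ψ.toFun x)) w := hga.fun_comp hψ
    have hT : ∀ j, taylorCoeff (j + 1) f a = taylorCoeff j g a := by
      intro j
      rw [← taylorCoeff_succ_sub_smul hga j]
      have h := taylorCoeff_sum_smul (Finset.univ : Finset (Fin 2))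
        (f := ![fun _ => f a, fun v => (v - a) • g v]) (z := a) (fun _ => 1)
        (by
          intro i _
          fin_cases i
          · exact analyticAt_const
          · exact (analyticAt_id.sub analyticAt_const).smul hga) (j + 1)
      simp only [Fin.sum_univ_two, one_smul, Matrix.cons_val_zero, Matrix.cons_val_one,
        taylorCoeff_const, Nat.succ_ne_zero, if_false, zero_add] at h
      rw [← h, ← hfg]
    have hcomp : taylorCoeff i (fun x => f (ψ.toFun x)) w = (if i = 0 then f a else 0) +
        taylorCoeff i (fun x => (ψ.toFun x - a) • g (ψ.toFun x)) w := by
      have h := taylorCoeff_sum_smul (Finset.univ : Finset (Fin 2))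
        (f := ![fun _ => f a, fun x => (ψ.toFun x - a) • g (ψ.toFun x)]) (z := w) (fun _ => 1)
        (by
          intro i _
          fin_cases i
          · exact analyticAt_const
          · exact (hψ.sub analyticAt_const).smul hgψ) i
      simp only [Fin.sum_univ_two, one_smul, Matrix.cons_val_zero, Matrix.cons_val_one,
        taylorCoeff_const] at h
      rw [← h]
      congr 1
      funext x
      exact congrFun hfg _
    have hs : ∀ k, taylorCoeff k (fun x => ψ.toFun x - a) w = PowerSeries.coeff k (ψ.series w) := by
      intro k
      rw [series, PowerSeries.coeff_mk]
      split_ifs with hk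
      · subst hk; simp [taylorCoeff_zero, ha]
      · rw [taylorCoeff, taylorCoeff, iteratedDeriv_fun_sub hψ.contDiffAt contDiffAt_const]
        simp [iteratedDeriv_const, hk]
    have hprod : taylorCoeff i (fun x => (ψ.toFun x - a) • g (ψ.toFun x)) w =
        ∑ j ∈ Finset.range n, PowerSeries.coeff i (ψ.series w ^ (j + 1)) •
          taylorCoeff j g a := by
      rw [taylorCoeff_smul_analyticAt (f := fun x => ψ.toFun x - a) (hψ.sub analyticAt_const) hgψ]
      simp only [pow_succ', PowerSeries.coeff_mul, Finset.sum_smul]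
      rw [Finset.sum_comm]
      refine Finset.sum_congr rfl fun p hp => ?_
      rw [hs]
      -- `ψ.series w` has no constant term, so only p.1 ≥ 1 counts; then p.2 < i ≤ n and the
      -- induction hypothesis applies to `g`.
      rcases Nat.eq_zero_or_pos p.1 with h0 | h0
      · simp [h0, series]
      · have hp' : p.1 + p.2 = i := Finset.HasAntidiagonal.mem_antidiagonal.1 hp
        rw [ih hga (by omega : p.2 < n), Finset.smul_sum]
        simp only [smul_smul]
    rw [hcomp, hprod, Finset.sum_range_succ', add_comm]
    simp only [hT, pow_zero, PowerSeries.coeff_one, taylorCoeff_zero, ite_smul, one_smul, zero_smul]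

theorem taylorCoeff_comp_fin (ψ : ConformalEquiv V U) {w : ℂ} (hw : w ∈ V) {f : ℂ → S}
    (hf : AnalyticAt ℂ f (ψ.toFun w)) {n : ℕ} (i : Fin n) :
    taylorCoeff i (fun x => f (ψ.toFun x)) w =
      ∑ j, ψ.faaDiBruno n w i j • taylorCoeff j f (ψ.toFun w) := by
  rw [ψ.taylorCoeff_comp hw hf i.2, ← Fin.sum_univ_eq_sum_range
    (fun j => PowerSeries.coeff (i : ℕ) (ψ.series w ^ j) • taylorCoeff j f (ψ.toFun w))]
  rfl

theorem faaDiBruno_inv_smul (ψ : ConformalEquiv V U) {w : ℂ} (hw : w ∈ V) {n : ℕ}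
    (x : Fin n → S) (k : Fin n) :
    ∑ i, (ψ.faaDiBruno n w)⁻¹ k i • ∑ j, ψ.faaDiBruno n w i j • x j = x k := by
  have hA : (ψ.faaDiBruno n w)⁻¹ * ψ.faaDiBruno n w = 1 :=
    Matrix.nonsing_inv_mul _ (isUnit_iff_ne_zero.2 (ψ.det_faaDiBruno_ne_zero n hw))
  simp only [Finset.smul_sum, smul_smul]
  rw [Finset.sum_comm]
  simp only [← Finset.sum_smul, ← Matrix.mul_apply, hA, Matrix.one_apply, ite_smul, one_smul,
    zero_smul, Finset.sum_ite_eq, Finset.mem_univ, if_true]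

theorem faaDiBruno_smul_inv (ψ : ConformalEquiv V U) {w : ℂ} (hw : w ∈ V) {n : ℕ}
    (x : Fin n → S) (k : Fin n) :
    ∑ i, ψ.faaDiBruno n w k i • ∑ j, (ψ.faaDiBruno n w)⁻¹ i j • x j = x k := by
  have hA : ψ.faaDiBruno n w * (ψ.faaDiBruno n w)⁻¹ = 1 :=
    Matrix.mul_nonsing_inv _ (isUnit_iff_ne_zero.2 (ψ.det_faaDiBruno_ne_zero n hw))
  simp only [Finset.smul_sum, smul_smul]
  rw [Finset.sum_comm]
  simp only [← Finset.sum_smul, ← Matrix.mul_apply, hA, Matrix.one_apply, ite_smul, one_smul,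
    zero_smul, Finset.sum_ite_eq, Finset.mem_univ, if_true]

/-- Vanishing of the Taylor coefficients of low order is invariant under conformal maps. -/
theorem taylorCoeff_comp_eq_zero (ψ : ConformalEquiv V U) {w : ℂ} (hw : w ∈ V) {f : ℂ → S}
    (hf : AnalyticAt ℂ f (ψ.toFun w)) {n : ℕ}
    (h : ∀ j < n, taylorCoeff j f (ψ.toFun w) = 0) :
    ∀ i < n, taylorCoeff i (fun x => f (ψ.toFun x)) w = 0 := by
  intro i hi
  rw [ψ.taylorCoeff_comp hw hf hi]
  exact Finset.sum_eq_zero fun j hj => by rw [h j (Finset.mem_range.1 hj), smul_zero]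

end ConformalEquiv

/-! ### Operators induced on Rochberg spaces. -/

namespace AnalyticSpace

variable {U V : Opens ℂ} {S S' : Type*} [NormedAddCommGroup S] [NormedSpace ℂ S] [CompleteSpace S]
  [NormedAddCommGroup S'] [NormedSpace ℂ S'] [CompleteSpace S']

namespace Rochberg

theorem val_mk (X : AnalyticSpace U S) (n : ℕ) (z : U) (f : X.carrier) :
    val X n z (mk X n z f) = X.jet n z f := rfl

theorem val_injective (X : AnalyticSpace U S) (n : ℕ) (z : U) :
    Function.Injective (val X n z) := Subtype.val_injective

theorem mk_surjective (X : AnalyticSpace U S) (n : ℕ) (z : U) :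
    Function.Surjective (mk X n z) := LinearMap.surjective_rangeRestrict _

theorem mk_eq_zero_iff (X : AnalyticSpace U S) (n : ℕ) (z : U) (f : X.carrier) :
    mk X n z f = 0 ↔ ∀ i < n, taylorCoeff i (X.toFun f) z = 0 := by
  rw [← (val_injective X n z).eq_iff, val_mk, map_zero]
  exact ⟨fun h i hi => congrFun h ⟨i, hi⟩, fun h => funext fun i => h i i.2⟩

theorem norm_mk_le (X : AnalyticSpace U S) (n : ℕ) (z : U) (f : X.carrier) :
    ‖mk X n z f‖ ≤ ‖f‖ := norm_le X n z rfl

section Map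

variable {X : AnalyticSpace U S} {Y : AnalyticSpace V S'} {n k : ℕ} {z : U} {w : V}

theorem mk_comp_eq (A : X.carrier →L[ℂ] Y.carrier)
    (h : ∀ f, mk X n z f = 0 → mk Y k w (A f) = 0) {f g : X.carrier}
    (hfg : mk X n z f = mk X n z g) : mk Y k w (A f) = mk Y k w (A g) := by
  have := h (f - g) (by rw [map_sub, hfg, sub_self])
  rwa [map_sub, map_sub, sub_eq_zero] at this

/-- The operator between Rochberg spaces induced by an operator between spaces of analytic
functions that preserves the vanishing of jets. -/
def map (A : X.carrier →L[ℂ] Y.carrier) (h : ∀ f, mk X n z f = 0 → mk Y k w (A f) = 0) :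
    X.Rochberg n z →L[ℂ] Y.Rochberg k w :=
  LinearMap.mkContinuous
    { toFun := fun x => mk Y k w (A (Function.surjInv (mk_surjective X n z) x))
      map_add' := fun x y => by
        rw [← _root_.map_add, ← _root_.map_add]
        exact mk_comp_eq A h (by simp only [_root_.map_add, Function.surjInv_eq])
      map_smul' := fun c x => by
        rw [RingHom.id_apply, ← _root_.map_smul, ← _root_.map_smul]
        exact mk_comp_eq A h (by simp only [_root_.map_smul, Function.surjInv_eq]) }
    ‖A‖ fun x => by
      refine le_of_forall_pos_le_add fun e he => ?_
      -- The representative given by `surjInv` may have a large norm; the bound is read off a nearly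
      -- optimal one. The 1 in the denominator covers the case ‖A‖ = 0.
      obtain ⟨f, hf, hlt⟩ := exists_norm_lt X n z x (e := e / (‖A‖ + 1)) (by positivity)
      have hf' : mk X n z f = x := val_injective X n z hf
      have h1 : ‖mk Y k w (A (Function.surjInv (mk_surjective X n z) x))‖ ≤ ‖A f‖ := by
        rw [mk_comp_eq A h (g := f) ((Function.surjInv_eq _ _).trans hf'.symm)]
        exact norm_mk_le _ _ _ _
      have h2 : ‖A‖ * (e / (‖A‖ + 1)) ≤ e := by
        rw [← mul_div_assoc, div_le_iff₀ (by positivity)]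
        nlinarith [norm_nonneg A]
      refine h1.trans ((A.le_opNorm f).trans ?_)
      nlinarith [mul_le_mul_of_nonneg_left hlt.le (norm_nonneg A)]

theorem map_mk (A : X.carrier →L[ℂ] Y.carrier) (h : ∀ f, mk X n z f = 0 → mk Y k w (A f) = 0)
    (f : X.carrier) : map A h (mk X n z f) = mk Y k w (A f) :=
  mk_comp_eq A h (Function.surjInv_eq _ _)

end Map

end Rochberg

/-! ### What acceptability provides: bounded coefficients and multiplication by φ - a. -/

variable {X : AnalyticSpace U S}

/-- The Taylor coefficients are bounded on an acceptable space. -/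
theorem IsAcceptable.exists_norm_taylorCoeff_le (hX : X.IsAcceptable) (z : U) (k : ℕ) :
    ∃ C : ℝ, ∀ f : X.carrier, ‖taylorCoeff k (X.toFun f) z‖ ≤ C * ‖f‖ := by
  have := hX.complete
  obtain ⟨r, hr, hrU⟩ := Metric.nhds_basis_closedBall.mem_iff.1 (U.isOpen.mem_nhds z.2)
  let δ : Metric.closedBall (z : ℂ) r → X.carrier →L[ℂ] S := fun u =>
    { toFun := fun f => X.toFun f u
      map_add' := fun f g => X.map_add f g u (hrU u.2)
      map_smul' := fun c f => X.map_smul c f u (hrU u.2)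
      cont := hX.continuous_eval u (hrU u.2) }
  -- Each f is bounded on the compact disc, so the evaluations there are uniformly bounded; Cauchy's
  -- estimate then bounds the coefficients.
  obtain ⟨C, hC⟩ := banach_steinhaus (g := δ) fun f => by
    obtain ⟨C, hC⟩ := (isCompact_closedBall (z : ℂ) r).exists_bound_of_continuousOn
      ((X.analytic f).continuousOn.mono hrU)
    exact ⟨C, fun u => hC u u.2⟩
  refine ⟨‖((k.factorial : ℂ))⁻¹‖ * (k.factorial * C / r ^ k), fun f => ?_⟩
  have hd : DiffContOnCl ℂ (X.toFun f) (Metric.ball (z : ℂ) r) :=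
    ((X.analytic f).differentiableOn.mono hrU).diffContOnCl_ball subset_rfl
  have h := Complex.norm_iteratedDeriv_le_of_forall_mem_sphere_norm_le (C := C * ‖f‖) k hr hd
    fun u hu => (δ ⟨u, Metric.sphere_subset_closedBall hu⟩).le_of_opNorm_le (hC _) f
  rw [taylorCoeff, norm_smul, mul_assoc]
  refine mul_le_mul_of_nonneg_left (h.trans_eq ?_) (norm_nonneg _)
  ring

/-- The quotient norm is a priori a seminorm. Bounded Taylor coefficients force a vector of norm 0
to vanish, which is needed for the closedness of the range of E. -/
theorem IsAcceptable.isClosed_singleton_zero (hX : X.IsAcceptable) (n : ℕ) (z : U) :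
    IsClosed ({0} : Set (X.Rochberg n z)) := by
  have h : ({0} : Set (X.Rochberg n z)) = {x | ‖x‖ = 0} := by
    ext x
    refine ⟨fun h => by rw [Set.mem_singleton_iff.1 h]; exact norm_zero, fun h => ?_⟩
    refine Rochberg.val_injective X n z (funext fun i => ?_)
    obtain ⟨C, hC⟩ := hX.exists_norm_taylorCoeff_le z i
    rw [map_zero, Pi.zero_apply, ← norm_le_zero_iff]
    refine le_of_forall_pos_le_add fun e he => ?_
    obtain ⟨f, hf, hlt⟩ := Rochberg.exists_norm_lt X n z x (e := e / (|C| + 1)) (by positivity)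
    have h0 : ‖x‖ = 0 := h
    rw [h0, zero_add] at hlt
    rw [← hf, zero_add]
    have h1 : |C| * (e / (|C| + 1)) ≤ e := by
      rw [← mul_div_assoc, div_le_iff₀ (by positivity)]
      nlinarith [abs_nonneg C]
    refine (hC f).trans ((mul_le_mul_of_nonneg_right (le_abs_self C) (norm_nonneg f)).trans ?_)
    exact (mul_le_mul_of_nonneg_left hlt.le (abs_nonneg C)).trans h1
  rw [h]
  exact isClosed_eq continuous_norm continuous_const

theorem rapidlyDecreasing_of_eq_zero {c : ℕ → ℂ} {N : ℕ} (hc : ∀ n, N ≤ n → c n = 0) :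
    RapidlyDecreasing c := by
  intro k
  refine ⟨∑ n ∈ Finset.range N, ‖c n‖ * ((n : ℝ) + 1) ^ k, ?_⟩
  rintro _ ⟨n, rfl⟩
  rcases lt_or_ge n N with h | h
  · exact Finset.single_le_sum (f := fun n : ℕ => ‖c n‖ * ((n : ℝ) + 1) ^ k)
      (fun i _ => by positivity) (Finset.mem_range.2 h)
  · simp only [hc n h, norm_zero, zero_mul]
    exact Finset.sum_nonneg fun i _ => by positivity

/-- Multiplication by `φ - a` is a bounded operator of an acceptable space. -/
theorem IsAcceptable.exists_mul (hX : X.IsAcceptable) (φ : ConformalEquiv U unitDisc) (a : ℂ) :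
    ∃ M : X.carrier →L[ℂ] X.carrier, ∀ f, ∀ u ∈ U,
      X.toFun (M f) u = (φ.toFun u - a) • X.toFun f u := by
  obtain ⟨k, C, h⟩ := hX.module φ
  -- The coefficients of the polynomial x - a.
  set c : ℕ → ℂ := fun n => if n = 0 then -a else if n = 1 then 1 else 0 with hc
  have hc0 : ∀ n, 2 ≤ n → c n = 0 := fun n hn => by
    simp [hc, show n ≠ 0 by omega, show n ≠ 1 by omega]
  have hsum : ∀ x : ℂ, ∑' n : ℕ, c n * x ^ n = x - a := fun x => by
    rw [tsum_eq_sum (s := Finset.range 2) fun n hn => by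
      rw [hc0 n (not_lt.1 fun h => hn (Finset.mem_range.2 h)), zero_mul]]
    simp [hc, Finset.sum_range_succ]
    ring
  choose g hg hgn using h c (rapidlyDecreasing_of_eq_zero hc0)
  simp only [hsum] at hg
  refine ⟨LinearMap.mkContinuous
    { toFun := g
      -- The products `g` were merely chosen; they depend linearly on f because elements are
      -- determined by their values on U.
      map_add' := fun f f' => X.injective _ _ fun u hu => by
        rw [hg _ u hu, X.map_add _ _ u hu, X.map_add _ _ u hu, hg _ u hu, hg _ u hu, smul_add]
      map_smul' := fun b f => X.injective _ _ fun u hu => by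
        rw [hg _ u hu, RingHom.id_apply, X.map_smul _ _ u hu, X.map_smul _ _ u hu, hg _ u hu,
          smul_comm] } (C * rapidNorm k c) hgn, fun f u hu => hg f u hu⟩

end AnalyticSpace

/-! ### Coordinates on the iterated twisted sums. -/

namespace AnalyticSpace

variable {U : Opens ℂ} {S : Type u} [NormedAddCommGroup S] [NormedSpace ℂ S] [CompleteSpace S]

section Twist

variable {n : ℕ} (Y : AnalyticSpace.{v, u} U (Fin n → S)) (X : AnalyticSpace.{v, u} U S)

/-- The coordinate `(fₙ, …, f₁, f) ↦ (fₙ, …, f₁) - τ_{[n,1]} f` of a twisted sum. -/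
def twistFst : (Y.twist X).carrier →L[ℂ] Y.carrier := WithLp.fstL 1 ℂ Y.carrier X.carrier

/-- The coordinate `(fₙ, …, f₁, f) ↦ f` of a twisted sum. -/
def twistSnd : (Y.twist X).carrier →L[ℂ] X.carrier := WithLp.sndL 1 ℂ Y.carrier X.carrier

/-- The element of a twisted sum with prescribed coordinates. -/
def twistPair : (Y.carrier × X.carrier) →L[ℂ] (Y.twist X).carrier :=
  ((WithLp.prodContinuousLinearEquiv 1 ℂ Y.carrier X.carrier).symm :
    (Y.carrier × X.carrier) →L[ℂ] WithLp 1 (Y.carrier × X.carrier))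

theorem twist_toFun_zero (p : (Y.twist X).carrier) (w : ℂ) :
    (Y.twist X).toFun p w 0 = X.toFun (twistSnd Y X p) w := rfl

theorem twist_toFun_succ (p : (Y.twist X).carrier) (w : ℂ) (i : Fin n) :
    (Y.twist X).toFun p w i.succ =
      Y.toFun (twistFst Y X p) w i + taylorCoeff (i + 1) (X.toFun (twistSnd Y X p)) w := rfl

theorem norm_twistPair (p : Y.carrier × X.carrier) : ‖twistPair Y X p‖ = ‖p.1‖ + ‖p.2‖ :=
  twist_norm Y X (WithLp.toLp 1 p)

end Twist

section Family

variable (X : AnalyticSpace.{v, u} U S)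

/-- The coordinates of an element of `X^{(n)}`, seen as an iterated twisted sum of copies of `X`. -/
def component : (n : ℕ) → ℕ → (X.family n).carrier →L[ℂ] X.carrier
  -- By recursion, the coordinates of index ≥ n are 0, so sums over a + b = i may be taken over the
  -- full antidiagonal, even at level i = n.
  | 0, _ => 0
  | n + 1, 0 => twistSnd (X.family n) X
  | n + 1, k + 1 => (component n k).comp (twistFst (X.family n) X)

/-- The element of `X^{(n)}` all of whose coordinates but one vanish. -/
def single : (n : ℕ) → ℕ → X.carrier →L[ℂ] (X.family n).carrier
  | 0, _ => 0
  | n + 1, 0 => (twistPair (X.family n) X).comp (ContinuousLinearMap.inr ℂ _ _)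
  | n + 1, k + 1 =>
    (twistPair (X.family n) X).comp ((ContinuousLinearMap.inl ℂ _ _).comp (single n k))

theorem component_single (n k l : ℕ) (f : X.carrier) :
    X.component n l (X.single n k f) = if l = k ∧ l < n then f else 0 := by
  induction n generalizing k l with
  | zero =>
    rw [if_neg (by omega)]
    cases l <;> rfl
  | succ n ih =>
    rcases k with _ | k <;> rcases l with _ | l
    · rw [if_pos (by omega)]; rfl
    · rw [if_neg (by omega)]; exact map_zero (X.component n l)
    · rw [if_neg (by omega)]; rfl
    · simp only [add_left_inj, add_lt_add_iff_right]
      exact ih k l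

theorem norm_single_zero {n : ℕ} (hn : 1 ≤ n) (f : X.carrier) : ‖X.single n 0 f‖ = ‖f‖ := by
  obtain ⟨n, rfl⟩ : ∃ l, n = l + 1 := ⟨n - 1, by omega⟩
  exact (norm_twistPair (X.family n) X (0, f)).trans (by simp)

/-- Each twist moves the earlier coordinates up by one index and adds the Taylor coefficients of the
new one; unrolling this leaves a sum over coordinate index plus order equal to `i`. -/
theorem family_toFun (n : ℕ) (p : (X.family n).carrier) (w : ℂ) (i : Fin n) :
    (X.family n).toFun p w i = ∑ q ∈ Finset.HasAntidiagonal.antidiagonal (i : ℕ),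
      taylorCoeff q.2 (X.toFun (X.component n q.1 p)) w := by
  induction n with
  | zero => exact i.elim0
  | succ n ih =>
    refine Fin.cases ?_ (fun i => ?_) i
    · rw [Fin.val_zero, Finset.Nat.antidiagonal_zero, Finset.sum_singleton, taylorCoeff_zero]
      exact twist_toFun_zero (X.family n) X p w
    · rw [Fin.val_succ, Finset.Nat.sum_antidiagonal_succ, add_comm (taylorCoeff _ _ _)]
      exact (twist_toFun_succ (X.family n) X p w i).trans (congrArg (· + _) (ih _ i))

theorem taylorCoeff_family (n l : ℕ) (p : (X.family n).carrier) {w : ℂ} (hw : w ∈ U) (i : Fin n) :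
    taylorCoeff l ((X.family n).toFun p) w i =
      ∑ q ∈ Finset.HasAntidiagonal.antidiagonal (i : ℕ),
        ((l + q.2).choose l : ℂ) • taylorCoeff (l + q.2) (X.toFun (X.component n q.1 p)) w := by
  rw [taylorCoeff_apply ((X.family n).analytic p w hw)]
  simp only [family_toFun]
  have h := taylorCoeff_sum_smul (Finset.HasAntidiagonal.antidiagonal (i : ℕ)) (z := w)
    (f := fun q => taylorCoeff q.2 (X.toFun (X.component n q.1 p))) (fun _ => 1)
    (fun q _ => taylorCoeff_analytic _ (X.analytic _) w hw) l
  simp only [one_smul] at h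
  rw [h]
  exact Finset.sum_congr rfl fun q _ => taylorCoeff_taylorCoeff _ _ _ _

end Family

end AnalyticSpace

/-! ### Weighted antidiagonal sums of Taylor coefficients at w. -/

namespace AnalyticSpace

section Coefficients

variable {U : Opens ℂ} {S : Type u} [NormedAddCommGroup S] [NormedSpace ℂ S] [CompleteSpace S]

/-- The Taylor coefficient of order `k` at `w` as a linear map on a space of analytic functions. -/
def coeff (X : AnalyticSpace.{v, u} U S) (w : U) (k : ℕ) : X.carrier →ₗ[ℂ] S where
  toFun f := taylorCoeff k (X.toFun f) w
  map_add' f g := taylorCoeff_add _ (X.analytic f) (X.analytic g) (X.map_add f g) w.2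
  map_smul' c f := taylorCoeff_smul _ c (X.map_smul c f) w.2

variable {X : AnalyticSpace.{v, u} U S} {w : U}

theorem mk_eq_zero_iff_coeff {n : ℕ} {f : X.carrier} :
    Rochberg.mk X n w f = 0 ↔ ∀ i < n, X.coeff w i f = 0 :=
  Rochberg.mk_eq_zero_iff X n w f

variable {M : X.carrier →L[ℂ] X.carrier}

theorem coeff_mul_zero (hM : ∀ f, ∀ u ∈ U, X.toFun (M f) u = (u - w) • X.toFun f u)
    (f : X.carrier) : X.coeff w 0 (M f) = 0 := by
  rw [coeff, LinearMap.coe_mk, AddHom.coe_mk, taylorCoeff_zero, hM f w w.2, sub_self, zero_smul]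

theorem coeff_mul_succ (hM : ∀ f, ∀ u ∈ U, X.toFun (M f) u = (u - w) • X.toFun f u)
    (f : X.carrier) (k : ℕ) : X.coeff w (k + 1) (M f) = X.coeff w k f := by
  rw [coeff, LinearMap.coe_mk, AddHom.coe_mk, coeff, LinearMap.coe_mk, AddHom.coe_mk,
    ← taylorCoeff_succ_sub_smul (X.analytic f w w.2)]
  refine taylorCoeff_congr ?_ _
  filter_upwards [U.isOpen.mem_nhds w.2] with u hu using hM f u hu

theorem coeff_mul_pow (hM : ∀ f, ∀ u ∈ U, X.toFun (M f) u = (u - w) • X.toFun f u)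
    (f : X.carrier) (k j : ℕ) :
    X.coeff w j ((M ^ k) f) = if k ≤ j then X.coeff w (j - k) f else 0 := by
  induction k generalizing j with
  | zero => simp
  | succ k ih =>
    rw [pow_succ', mul_apply_eq_comp]
    rcases j with _ | j
    · rw [coeff_mul_zero hM, if_neg (by omega)]
    · rw [coeff_mul_succ hM, ih]
      simp only [add_le_add_iff_right, Nat.add_sub_add_right]

/-- Multiplication by (u - w)^k shifts coefficients by k, so the terms with k > i drop out. This
turns the operators `retraction` and `defect` into weighted antidiagonal sums. -/
theorem coeff_sum_mul_pow (hM : ∀ f, ∀ u ∈ U, X.toFun (M f) u = (u - w) • X.toFun f u)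
    (c : ℕ → ℂ) (g : ℕ → X.carrier) {i N : ℕ} (hi : i < N) :
    X.coeff w i (∑ k ∈ Finset.range N, c k • (M ^ k) (g k)) =
      ∑ q ∈ Finset.HasAntidiagonal.antidiagonal i, c q.1 • X.coeff w q.2 (g q.1) := by
  rw [map_sum, Finset.Nat.sum_antidiagonal_eq_sum_range_succ
    (fun a b => c a • X.coeff w b (g a))]
  symm
  refine Finset.sum_subset_zero_on_sdiff (Finset.range_mono hi) ?_ ?_
  · intro k hk
    have : ¬ k ≤ i := fun h => (Finset.mem_sdiff.1 hk).2 (Finset.mem_range.2 (by omega))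
    rw [LinearMap.map_smul, coeff_mul_pow hM, if_neg this, smul_zero]
  · intro k hk
    have : k ≤ i := Nat.lt_succ_iff.1 (Finset.mem_range.1 hk)
    rw [LinearMap.map_smul, coeff_mul_pow hM, if_pos this]

variable (X w) (m : ℕ)

/-- The linear combinations, over the pairs with sum `i`, of the Taylor coefficients of the
coordinates of an element of `X^{(m)}`. -/
def antidiagonalCoeff (c : ℕ × ℕ → ℂ) (i : ℕ) : (X.family m).carrier →ₗ[ℂ] S :=
  ∑ q ∈ Finset.HasAntidiagonal.antidiagonal i,
    c q • (X.coeff w q.2).comp (X.component m q.1).toLinearMap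

variable {X w m}

theorem antidiagonalCoeff_apply (c : ℕ × ℕ → ℂ) (i : ℕ) (p : (X.family m).carrier) :
    X.antidiagonalCoeff w m c i p = ∑ q ∈ Finset.HasAntidiagonal.antidiagonal i,
      c q • X.coeff w q.2 (X.component m q.1 p) := by
  simp [antidiagonalCoeff, LinearMap.sum_apply]

/-- The sums are linear in the weight, and weights matter only where q.1 + q.2 = i. The later
verifications thus reduce to scalar identities in q.1 and q.2. -/
theorem antidiagonalCoeff_combination {c₁ c₂ c : ℕ × ℕ → ℂ} {i : ℕ} {a b : ℂ}
    (h : ∀ q : ℕ × ℕ, q.1 + q.2 = i → a * c₁ q + b * c₂ q = c q) (p : (X.family m).carrier) :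
    a • X.antidiagonalCoeff w m c₁ i p + b • X.antidiagonalCoeff w m c₂ i p =
      X.antidiagonalCoeff w m c i p := by
  simp only [antidiagonalCoeff_apply, Finset.smul_sum, ← Finset.sum_add_distrib, smul_smul,
    ← add_smul]
  exact Finset.sum_congr rfl fun q hq => by
    rw [h q (Finset.HasAntidiagonal.mem_antidiagonal.1 hq)]

/-- Differentiating the entry of index `i` turns order b into b + 1 with factor b + 1. After
reindexing this is the weight q.2 at level i + 1, the extra term q.2 = 0 costing nothing. The weight
1 at level m is not seen. -/
theorem mk_family_eq_zero_iff (p : (X.family m).carrier) :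
    Rochberg.mk (X.family m) 2 w p = 0 ↔ ∀ i < m,
      X.antidiagonalCoeff w m (fun _ => 1) i p = 0 ∧
      X.antidiagonalCoeff w m (fun q => q.2) (i + 1) p = 0 := by
  have h0 : ∀ i : Fin m, taylorCoeff 0 ((X.family m).toFun p) w i =
      X.antidiagonalCoeff w m (fun _ => 1) i p := by
    intro i
    rw [taylorCoeff_family _ _ _ _ w.2, antidiagonalCoeff_apply]
    refine Finset.sum_congr rfl fun q _ => ?_
    simp [coeff]
  have h1 : ∀ i : Fin m, taylorCoeff 1 ((X.family m).toFun p) w i =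
      X.antidiagonalCoeff w m (fun q => q.2) (i + 1) p := by
    intro i
    rw [taylorCoeff_family _ _ _ _ w.2, antidiagonalCoeff_apply,
      Finset.Nat.sum_antidiagonal_succ']
    simp only [Nat.cast_zero, zero_smul, zero_add]
    refine Finset.sum_congr rfl fun q _ => ?_
    rw [Nat.choose_one_right, add_comm 1]
    rfl
  rw [Rochberg.mk_eq_zero_iff]
  constructor
  · intro h i hi
    exact ⟨by simpa [h 0] using (h0 ⟨i, hi⟩).symm, by simpa [h 1] using (h1 ⟨i, hi⟩).symm⟩
  · intro h l hl
    obtain rfl | rfl : l = 0 ∨ l = 1 := by omega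
    · exact funext fun i => (h0 i).trans (h i i.2).1
    · exact funext fun i => (h1 i).trans (h i i.2).2

theorem antidiagonalCoeff_single_zero (hm : 1 ≤ m) (c : ℕ × ℕ → ℂ) (i : ℕ) (f : X.carrier) :
    X.antidiagonalCoeff w m c i (X.single m 0 f) = c (0, i) • X.coeff w i f := by
  rw [antidiagonalCoeff_apply, Finset.sum_eq_single ((0, i) : ℕ × ℕ)]
  · rw [component_single, if_pos ⟨rfl, hm⟩]
  · rintro ⟨a, b⟩ hab h
    have hab' : a + b = i := Finset.HasAntidiagonal.mem_antidiagonal.1 hab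
    have ha : a ≠ 0 := fun ha => h (by subst ha; simp; omega)
    rw [component_single, if_neg fun h => ha h.1, map_zero, smul_zero]
  · exact fun h => absurd (Finset.HasAntidiagonal.mem_antidiagonal.2 (by simp)) h

theorem antidiagonalCoeff_single_one (hm : 2 ≤ m) (c : ℕ × ℕ → ℂ) (i : ℕ) (f : X.carrier) :
    X.antidiagonalCoeff w m c (i + 1) (X.single m 1 f) = c (1, i) • X.coeff w i f := by
  rw [antidiagonalCoeff_apply, Finset.sum_eq_single ((1, i) : ℕ × ℕ)]
  · rw [component_single, if_pos ⟨rfl, hm⟩]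
  · rintro ⟨a, b⟩ hab h
    have hab' : a + b = i + 1 := Finset.HasAntidiagonal.mem_antidiagonal.1 hab
    have ha : a ≠ 1 := fun ha => h (by subst ha; simp; omega)
    rw [component_single, if_neg fun h => ha h.1, map_zero, smul_zero]
  · exact fun h => absurd (Finset.HasAntidiagonal.mem_antidiagonal.2 (by simp; omega)) h

theorem antidiagonalCoeff_zero_single_one (c : ℕ × ℕ → ℂ) (f : X.carrier) :
    X.antidiagonalCoeff w m c 0 (X.single m 1 f) = 0 := by
  rw [antidiagonalCoeff_apply, Finset.Nat.antidiagonal_zero, Finset.sum_singleton,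
    component_single, if_neg (by simp), map_zero, smul_zero]

end Coefficients

/-! ### The maps R, Q, J of the splitting and their identities modulo jets. -/

section Splitting

variable {U : Opens ℂ} {S : Type u} [NormedAddCommGroup S] [NormedSpace ℂ S] [CompleteSpace S]
  (X : AnalyticSpace.{v, u} U S) (m : ℕ) (M : X.carrier →L[ℂ] X.carrier)

/-- If `M` is the multiplication by `u - w`, this operator from `X^{(m)}` to `X` induces a
left inverse of the natural map `X^{(m+1)}_w → (X^{(m)})^{(2)}_w`. -/
def retraction : (X.family m).carrier →L[ℂ] X.carrier :=
  -- The weight is 1 at k = 0, whence a left inverse. On the level q.1 + q.2 = m it equals q.2 / m,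
  -- so the sum s_m, invisible in the 2-jet, is not needed.
  ∑ k ∈ Finset.range (m + 1), (1 - (k : ℂ) / m) • (M ^ k).comp (X.component m k)

/-- If `M` is the multiplication by `u - w`, this operator from `X^{(m)}` to `X` induces the
quotient map `(X^{(m)})^{(2)}_w → X^{(m-1)}_w`. -/
def defect : (X.family m).carrier →L[ℂ] X.carrier :=
  -- The weight q.1 kills the coordinate 0, so one factor u - w is cancelled: the coordinate k + 1
  -- comes with the power k.
  ∑ k ∈ Finset.range m, ((k : ℂ) + 1) • (M ^ k).comp (X.component m (k + 1))

/-- If `M` is the multiplication by `u - w`, this operator from `X` to `X^{(m)}` induces a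
right inverse of the map induced by `defect`. -/
def defectSection : X.carrier →L[ℂ] (X.family m).carrier :=
  -- The scalar 1/m - 1 is chosen to cancel the contribution 1 - 1/m of coordinate 1 under
  -- `retraction`.
  (X.single m 0).comp ((((m : ℂ))⁻¹ - 1) • M) + X.single m 1

variable {X m M} {w : U}

theorem retraction_apply (p : (X.family m).carrier) : X.retraction m M p =
    ∑ k ∈ Finset.range (m + 1), (1 - (k : ℂ) / m) • (M ^ k) (X.component m k p) := by
  simp [retraction]

theorem defect_apply (p : (X.family m).carrier) : X.defect m M p =
    ∑ k ∈ Finset.range m, ((k : ℂ) + 1) • (M ^ k) (X.component m (k + 1) p) := by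
  simp [defect]

theorem defectSection_apply (b : X.carrier) : X.defectSection m M b =
    X.single m 0 ((((m : ℂ))⁻¹ - 1) • M b) + X.single m 1 b := rfl

theorem coeff_retraction (hM : ∀ f, ∀ u ∈ U, X.toFun (M f) u = (u - w) • X.toFun f u)
    (p : (X.family m).carrier) {i : ℕ} (hi : i < m + 1) :
    X.coeff w i (X.retraction m M p) =
      X.antidiagonalCoeff w m (fun q => 1 - (q.1 : ℂ) / m) i p := by
  rw [retraction_apply, coeff_sum_mul_pow hM (fun k => 1 - (k : ℂ) / m)
    (fun k => X.component m k p) hi, antidiagonalCoeff_apply]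

theorem coeff_defect (hM : ∀ f, ∀ u ∈ U, X.toFun (M f) u = (u - w) • X.toFun f u)
    (p : (X.family m).carrier) {i : ℕ} (hi : i < m) :
    X.coeff w i (X.defect m M p) = X.antidiagonalCoeff w m (fun q => q.1) (i + 1) p := by
  rw [defect_apply, coeff_sum_mul_pow hM (fun k => (k : ℂ) + 1)
    (fun k => X.component m (k + 1) p) hi, antidiagonalCoeff_apply,
    Finset.Nat.sum_antidiagonal_succ]
  simp

theorem antidiagonalCoeff_defectSection_zero
    (hM : ∀ f, ∀ u ∈ U, X.toFun (M f) u = (u - w) • X.toFun f u) (hm : 1 ≤ m) (b : X.carrier) :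
    X.antidiagonalCoeff w m (fun _ => 1) 0 (X.defectSection m M b) = 0 := by
  rw [defectSection_apply, LinearMap.map_add, antidiagonalCoeff_single_zero hm,
    antidiagonalCoeff_zero_single_one, LinearMap.map_smul, coeff_mul_zero hM]
  simp

theorem antidiagonalCoeff_defectSection_succ
    (hM : ∀ f, ∀ u ∈ U, X.toFun (M f) u = (u - w) • X.toFun f u) (b : X.carrier) {i : ℕ}
    (hi : i + 1 < m) :
    X.antidiagonalCoeff w m (fun _ => 1) (i + 1) (X.defectSection m M b) =
      ((m : ℂ))⁻¹ • X.coeff w i b := by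
  rw [defectSection_apply, LinearMap.map_add, antidiagonalCoeff_single_zero (by omega),
    antidiagonalCoeff_single_one (by omega), LinearMap.map_smul, coeff_mul_succ hM, smul_smul,
    ← add_smul]
  congr 1
  ring

theorem antidiagonalCoeff_snd_defectSection
    (hM : ∀ f, ∀ u ∈ U, X.toFun (M f) u = (u - w) • X.toFun f u) (hm : 1 ≤ m) (b : X.carrier)
    {i : ℕ} (hi : i < m) :
    X.antidiagonalCoeff w m (fun q => q.2) (i + 1) (X.defectSection m M b) =
      (((i : ℂ) + 1) / m - 1) • X.coeff w i b := by
  rw [defectSection_apply, LinearMap.map_add, antidiagonalCoeff_single_zero hm,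
    LinearMap.map_smul, coeff_mul_succ hM, smul_smul]
  rcases Nat.lt_or_ge m 2 with h | h
  · obtain rfl : m = 1 := by omega
    obtain rfl : i = 0 := by omega
    have : X.antidiagonalCoeff w 1 (fun q => q.2) (0 + 1) (X.single 1 1 b) = 0 := by
      rw [antidiagonalCoeff_apply]
      exact Finset.sum_eq_zero fun q _ => by
        rw [component_single, if_neg (by omega), map_zero, smul_zero]
    rw [this]
    simp
  · rw [antidiagonalCoeff_single_one h, ← add_smul]
    congr 1
    push_cast
    ring

/-- On level i, 1 - q.1/m = (1 - i/m) + q.2/m. At i = m the first term vanishes, so the missing s_m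
is harmless. -/
theorem mk_retraction_eq_zero (hM : ∀ f, ∀ u ∈ U, X.toFun (M f) u = (u - w) • X.toFun f u)
    (hm : 1 ≤ m) (p : (X.family m).carrier) (hp : Rochberg.mk (X.family m) 2 w p = 0) :
    Rochberg.mk X (m + 1) w (X.retraction m M p) = 0 := by
  have hm0 : (m : ℂ) ≠ 0 := by exact_mod_cast (by omega : m ≠ 0)
  rw [mk_family_eq_zero_iff] at hp
  rw [mk_eq_zero_iff_coeff]
  intro i hi
  rw [coeff_retraction hM p hi]
  rcases i with _ | i
  -- Level 0 contains only the pair (0, 0), where both weights are 1.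
  · rw [← (hp 0 (by omega)).1, antidiagonalCoeff_apply, antidiagonalCoeff_apply]
    simp
  · rw [← antidiagonalCoeff_combination (c₁ := fun _ => 1) (c₂ := fun q => q.2)
      (a := 1 - ((i : ℂ) + 1) / m) (b := ((m : ℂ))⁻¹) (fun q hq => ?_),
      (hp i (by omega)).2, smul_zero, add_zero]
    · rcases Nat.lt_or_ge (i + 1) m with h | h
      · rw [(hp _ h).1, smul_zero]
      · have : (m : ℂ) = i + 1 := by exact_mod_cast (by omega : m = i + 1)
        rw [← this, div_self hm0, sub_self, zero_smul]
    · have : (q.1 : ℂ) + q.2 = i + 1 := by exact_mod_cast hq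
      rw [← this]
      ring

/-- On level i + 1, q.1 = (i + 1) - q.2. The sums s_{i+1} are visible only for i + 1 < m, hence the
target of order m - 1. -/
theorem mk_defect_eq_zero (hM : ∀ f, ∀ u ∈ U, X.toFun (M f) u = (u - w) • X.toFun f u)
    (p : (X.family m).carrier) (hp : Rochberg.mk (X.family m) 2 w p = 0) :
    Rochberg.mk X (m - 1) w (X.defect m M p) = 0 := by
  rw [mk_family_eq_zero_iff] at hp
  rw [mk_eq_zero_iff_coeff]
  intro i hi
  rw [coeff_defect hM p (by omega), ← antidiagonalCoeff_combination (c₁ := fun _ => 1)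
    (c₂ := fun q => q.2) (a := (i : ℂ) + 1) (b := -1) (fun q hq => ?_),
    (hp (i + 1) (by omega)).1, (hp i (by omega)).2, smul_zero, smul_zero, add_zero]
  have : (q.1 : ℂ) + q.2 = i + 1 := by exact_mod_cast hq
  rw [← this]
  ring

theorem mk_single_eq_zero (hm : 1 ≤ m) (f : X.carrier) (hf : Rochberg.mk X (m + 1) w f = 0) :
    Rochberg.mk (X.family m) 2 w (X.single m 0 f) = 0 := by
  rw [mk_eq_zero_iff_coeff] at hf
  rw [mk_family_eq_zero_iff]
  intro i hi
  rw [antidiagonalCoeff_single_zero hm, antidiagonalCoeff_single_zero hm, hf i (by omega),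
    hf (i + 1) (by omega), smul_zero, smul_zero]
  exact ⟨rfl, rfl⟩

/-- The sum t_{i+1} of the section is ((i + 1)/m - 1) times the coefficient of order i of b. The
factor vanishes at i = m - 1, so m - 1 coefficients of b suffice. -/
theorem mk_defectSection_eq_zero (hM : ∀ f, ∀ u ∈ U, X.toFun (M f) u = (u - w) • X.toFun f u)
    (hm : 1 ≤ m) (b : X.carrier) (hb : Rochberg.mk X (m - 1) w b = 0) :
    Rochberg.mk (X.family m) 2 w (X.defectSection m M b) = 0 := by
  rw [mk_eq_zero_iff_coeff] at hb
  rw [mk_family_eq_zero_iff]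
  intro i hi
  constructor
  · rcases i with _ | i
    · exact antidiagonalCoeff_defectSection_zero hM hm b
    · rw [antidiagonalCoeff_defectSection_succ hM b hi, hb i (by omega), smul_zero]
  · rw [antidiagonalCoeff_snd_defectSection hM hm b hi]
    rcases Nat.lt_or_ge i (m - 1) with h | h
    · rw [hb i h, smul_zero]
    · have : (m : ℂ) = i + 1 := by exact_mod_cast (by omega : m = i + 1)
      have hm0 : (m : ℂ) ≠ 0 := by exact_mod_cast (by omega : m ≠ 0)
      rw [← this, div_self hm0, sub_self, zero_smul]

theorem retraction_single (hm : 1 ≤ m) (f : X.carrier) :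
    X.retraction m M (X.single m 0 f) = f := by
  rw [retraction_apply, Finset.sum_eq_single 0]
  · rw [component_single, if_pos ⟨rfl, hm⟩]; simp
  · intro k _ hk
    rw [component_single, if_neg fun h => hk h.1, map_zero, smul_zero]
  · simp

theorem defect_single (f : X.carrier) : X.defect m M (X.single m 0 f) = 0 := by
  rw [defect_apply]
  refine Finset.sum_eq_zero fun k _ => ?_
  rw [component_single, if_neg (by omega), map_zero, smul_zero]

theorem retraction_defectSection (hm : 1 ≤ m) (b : X.carrier) :
    X.retraction m M (X.defectSection m M b) = 0 := by
  rw [defectSection_apply, _root_.map_add, retraction_single hm, retraction_apply,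
    Finset.sum_eq_single 1]
  · rw [component_single, pow_one]
    rcases Nat.lt_or_ge 1 m with h | h
    · rw [if_pos ⟨rfl, h⟩, ← add_smul]
      simp
    · obtain rfl : m = 1 := by omega
      simp
  · intro k _ hk
    rw [component_single, if_neg fun h => hk h.1, map_zero, smul_zero]
  · intro h
    exact absurd (Finset.mem_range.2 (by omega)) h

theorem mk_defect_defectSection (b : X.carrier) :
    Rochberg.mk X (m - 1) w (X.defect m M (X.defectSection m M b)) = Rochberg.mk X (m - 1) w b := by
  rcases Nat.lt_or_ge 1 m with h | h
  · congr 1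
    rw [defectSection_apply, _root_.map_add, defect_single, zero_add, defect_apply,
      Finset.sum_eq_single 0]
    · rw [component_single, if_pos ⟨rfl, h⟩]; simp
    · intro k _ hk
      rw [component_single, if_neg (by omega), map_zero, smul_zero]
    · intro h'
      exact absurd (Finset.mem_range.2 (by omega)) h'
  -- For m = 1 coordinate 1 does not exist, but the target is the zero space.
  · rw [← sub_eq_zero, ← map_sub, mk_eq_zero_iff_coeff]
    intro i hi
    omega

/-- With a + b = i, the two kinds of sums reduce to (1 - a/m) + a/m = 1 and i(1 - a/m) + (i/m - 1)a
= b. -/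
theorem mk_single_retraction_add (hM : ∀ f, ∀ u ∈ U, X.toFun (M f) u = (u - w) • X.toFun f u)
    (hm : 1 ≤ m) (p : (X.family m).carrier) :
    Rochberg.mk (X.family m) 2 w
      (X.single m 0 (X.retraction m M p) + X.defectSection m M (X.defect m M p) - p) = 0 := by
  have hm0 : (m : ℂ) ≠ 0 := by exact_mod_cast (by omega : m ≠ 0)
  rw [mk_family_eq_zero_iff]
  intro i hi
  simp only [map_sub, LinearMap.map_add, sub_eq_zero, antidiagonalCoeff_single_zero hm]
  constructor
  · rw [coeff_retraction hM p (by omega), one_smul]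
    rcases i with _ | i
    · rw [antidiagonalCoeff_defectSection_zero hM hm, add_zero, antidiagonalCoeff_apply,
        antidiagonalCoeff_apply]
      simp
    · rw [antidiagonalCoeff_defectSection_succ hM _ hi, coeff_defect hM p (by omega)]
      have := antidiagonalCoeff_combination (X := X) (w := w) (i := i + 1)
        (c₁ := fun q => 1 - (q.1 : ℂ) / m) (c₂ := fun q => q.1) (c := fun _ => 1) (a := 1)
        (b := ((m : ℂ))⁻¹) (fun q _ => by ring) p
      rwa [one_smul] at this
  · rw [coeff_retraction hM p (by omega), antidiagonalCoeff_snd_defectSection hM hm _ hi,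
      coeff_defect hM p hi]
    refine antidiagonalCoeff_combination (fun q hq => ?_) p
    have : (q.1 : ℂ) + q.2 = i + 1 := by exact_mod_cast hq
    push_cast
    linear_combination -this

end Splitting

end AnalyticSpace

/-! ### Transfer between the disc and U. -/

namespace AnalyticSpace

section Transfer

variable {U : Opens ℂ} {S : Type u} [NormedAddCommGroup S] [NormedSpace ℂ S] [CompleteSpace S]

/-- By Leibniz, a coefficient of order l of the product involves only coefficients of `f` of order
at most l. -/
theorem taylorCoeff_matrix_eq_zero {ι : Type*} [Fintype ι] {A : ℂ → Matrix ι ι ℂ} {f : ℂ → ι → S}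
    {z : ℂ} (hA : ∀ i j, AnalyticAt ℂ (fun u => A u i j) z) (hf : AnalyticAt ℂ f z) {n : ℕ}
    (h : ∀ l < n, taylorCoeff l f z = 0) :
    ∀ l < n, taylorCoeff l (fun u i => ∑ j, A u i j • f u j) z = 0 := by
  intro l hl
  have hfj : ∀ j, AnalyticAt ℂ (fun u => f u j) z := analyticAt_pi_iff.1 hf
  have han : ∀ i j, AnalyticAt ℂ (fun u => A u i j • f u j) z := fun i j => (hA i j).smul (hfj j)
  ext i
  rw [taylorCoeff_apply (analyticAt_pi_iff.2 fun i => Finset.analyticAt_fun_sum _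
    fun j _ => han i j)]
  have h1 := taylorCoeff_sum_smul Finset.univ (fun _ => 1) (fun j _ => han i j) l
  simp only [one_smul] at h1
  rw [h1]
  refine Finset.sum_eq_zero fun j _ => ?_
  rw [taylorCoeff_smul_analyticAt (hA i j) (hfj j)]
  refine Finset.sum_eq_zero fun p hp => ?_
  have hp' : p.1 + p.2 = l := Finset.HasAntidiagonal.mem_antidiagonal.1 hp
  rw [← taylorCoeff_apply hf, h p.2 (by omega), Pi.zero_apply, smul_zero]

variable (X : AnalyticSpace.{v, u} U S) (ψ : ConformalEquiv unitDisc U)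

theorem mk_pullback_eq_zero_iff (n : ℕ) {z : U} {w : unitDisc} (hw : ψ.invFun z = w)
    (f : X.carrier) : Rochberg.mk (X.pullback ψ) n w f = 0 ↔ Rochberg.mk X n z f = 0 := by
  have hz : ψ.toFun w = z := by rw [← hw, ψ.right_inv z z.2]
  refine (Rochberg.mk_eq_zero_iff (X.pullback ψ) n w f).trans
    (Iff.trans ?_ (Rochberg.mk_eq_zero_iff X n z f).symm)
  constructor
  · intro h i hi
    have h1 := ψ.symm.taylorCoeff_comp_eq_zero z.2 (f := (X.pullback ψ).toFun f) (n := n)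
      (by rw [show ψ.symm.toFun z = w from hw]; exact (X.pullback ψ).analytic f w w.2)
      (by rw [show ψ.symm.toFun z = w from hw]; exact h) i hi
    rw [← h1]
    refine taylorCoeff_congr ?_ _
    filter_upwards [U.isOpen.mem_nhds z.2] with u hu
    exact (congrArg (X.toFun f) (ψ.right_inv u hu)).symm
  · intro h
    exact ψ.taylorCoeff_comp_eq_zero w.2 (by rw [hz]; exact X.analytic f z z.2) (by rwa [hz])

/-- The two functions differ by a conformal change of variable and an analytic matrix with analytic
inverse, and both preserve vanishing jets in either direction. -/
theorem mk_rochbergFamily_eq_zero_iff (m n : ℕ) {z : U} {w : unitDisc} (hw : ψ.invFun z = w)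
    (p : ((X.pullback ψ).family m).carrier) :
    Rochberg.mk (X.rochbergFamily ψ m) n z p = 0 ↔
      Rochberg.mk ((X.pullback ψ).family m) n w p = 0 := by
  have hz : ψ.toFun w = z := by rw [← hw, ψ.right_inv z z.2]
  have hψ : AnalyticAt ℂ ψ.invFun z := ψ.symm.analyticAt z.2
  have hG := ((X.pullback ψ).family m).analytic p w w.2
  have hH := (X.rochbergFamily ψ m).analytic p z z.2
  refine (Rochberg.mk_eq_zero_iff (X.rochbergFamily ψ m) n z p).trans
    (Iff.trans ?_ (Rochberg.mk_eq_zero_iff ((X.pullback ψ).family m) n w p).symm)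
  constructor
  · intro h l hl
    have h1 := ψ.taylorCoeff_comp_eq_zero w.2 (f := (X.rochbergFamily ψ m).toFun p) (n := n)
      (by rw [hz]; exact hH) (by rw [hz]; exact h)
    have h2 := taylorCoeff_matrix_eq_zero (A := ψ.faaDiBruno m)
      (fun i j => ψ.faaDiBruno_analytic m i j w w.2)
      (AnalyticAt.fun_comp (by rw [hz]; exact hH) (ψ.analyticAt w.2)) h1 l hl
    rw [← h2]
    refine taylorCoeff_congr ?_ _
    filter_upwards [unitDisc.isOpen.mem_nhds w.2] with x hx
    ext i
    rw [← ψ.faaDiBruno_smul_inv hx (((X.pullback ψ).family m).toFun p x) i]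
    simp only [rochbergFamily, ψ.left_inv x hx]
  · intro h l hl
    have h1 := ψ.symm.taylorCoeff_comp_eq_zero z.2 (f := ((X.pullback ψ).family m).toFun p) (n := n)
      (by rw [show ψ.symm.toFun z = w from hw]; exact hG)
      (by rw [show ψ.symm.toFun z = w from hw]; exact h)
    refine taylorCoeff_matrix_eq_zero (A := fun u => (ψ.faaDiBruno m (ψ.invFun u))⁻¹)
      (fun i j => ?_) (AnalyticAt.fun_comp (by rw [hw]; exact hG) hψ) h1 l hl
    exact (analyticOnNhd_matrix_inv (ψ.faaDiBruno_analytic m)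
      (fun z hz => ψ.det_faaDiBruno_ne_zero m hz) i j _ (ψ.inv_mem z z.2)).fun_comp hψ

/-- The arrays `τ_{(m,0]} f` belong to `rochbergFamily`. -/
theorem rochbergFamily_single (m : ℕ) (hm : 1 ≤ m) (f : X.carrier) (u : U) :
    (X.rochbergFamily ψ m).toFun ((X.pullback ψ).single m 0 f) u = X.jet m u f := by
  have hu := ψ.inv_mem u u.2
  have h : ∀ j : Fin m, ((X.pullback ψ).family m).toFun ((X.pullback ψ).single m 0 f)
      (ψ.invFun u) j = ∑ k, ψ.faaDiBruno m (ψ.invFun u) j k • X.jet m u f k := by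
    intro j
    rw [family_toFun]
    have h1 := antidiagonalCoeff_single_zero (X := X.pullback ψ) (w := ⟨_, hu⟩) hm (fun _ => 1) j f
    rw [antidiagonalCoeff_apply, one_smul] at h1
    simp only [one_smul] at h1
    refine h1.trans ?_
    have h2 := ψ.taylorCoeff_comp_fin hu (f := X.toFun f)
      (by rw [ψ.right_inv u u.2]; exact X.analytic f u u.2) j
    rw [ψ.right_inv u u.2] at h2
    exact h2
  ext i
  simp only [rochbergFamily, h]
  exact ψ.faaDiBruno_inv_smul hu (X.jet m u f) i

theorem rochbergFamily_jet_single (m n : ℕ) (hm : 1 ≤ m) (f : X.carrier) (z : U) (i : Fin n)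
    (j : Fin m) : (X.rochbergFamily ψ m).jet n z ((X.pullback ψ).single m 0 f) i j =
      (((i : ℕ) + (j : ℕ)).choose (i : ℕ) : ℂ) • taylorCoeff ((i : ℕ) + j) (X.toFun f) z := by
  rw [← taylorCoeff_taylorCoeff]
  refine (taylorCoeff_apply ((X.rochbergFamily ψ m).analytic _ z z.2) _ _).trans ?_
  refine taylorCoeff_congr ?_ _
  filter_upwards [U.isOpen.mem_nhds z.2] with u hu
  rw [rochbergFamily_single X ψ m hm f ⟨u, hu⟩]
  rfl

end Transfer

end AnalyticSpace

/-! ### Split exact sequences of topological vector spaces. -/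

section SplitSequence

variable {A B C : Type*} [TopologicalSpace A] [AddCommGroup A] [Module ℂ A]
  [TopologicalSpace B] [AddCommGroup B] [Module ℂ B] [IsTopologicalAddGroup B]
  [TopologicalSpace C] [AddCommGroup C] [Module ℂ C]
  {E : A →L[ℂ] B} {R : B →L[ℂ] A} {Q : B →L[ℂ] C} {J : C →L[ℂ] B}

theorem range_eq_ker_of_split (hQE : ∀ a, Q (E a) = 0)
    (hsum : ∀ b, E (R b) + J (Q b) = b) :
    LinearMap.range (E : A →ₗ[ℂ] B) = LinearMap.ker (Q : B →ₗ[ℂ] C) := by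
  ext b
  constructor
  · rintro ⟨a, rfl⟩
    exact hQE a
  · intro hb
    refine ⟨R b, ?_⟩
    have hb' : Q b = 0 := hb
    have := hsum b
    rwa [hb', map_zero, add_zero] at this

/-- The left inverse gives the embedding; the range is the kernel of `Q`, closed as soon as {0} is
closed in `C`. -/
theorem isClosedEmbedding_of_split (hC : IsClosed ({0} : Set C)) (hRE : ∀ a, R (E a) = a)
    (hQE : ∀ a, Q (E a) = 0) (hsum : ∀ b, E (R b) + J (Q b) = b) :
    Topology.IsClosedEmbedding E := by
  refine ⟨Topology.IsEmbedding.of_leftInverse hRE R.continuous E.continuous, ?_⟩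
  have h : Set.range E = Q ⁻¹' {0} := by
    have := congrArg (fun p : Submodule ℂ B => (p : Set B)) (range_eq_ker_of_split hQE hsum)
    exact this
  rw [h]
  exact hC.preimage Q.continuous

theorem closedComplemented_of_leftInverse (hRE : ∀ a, R (E a) = a) :
    (LinearMap.range (E : A →ₗ[ℂ] B)).ClosedComplemented :=
  ⟨(E.comp R).codRestrict _ fun b => ⟨R b, rfl⟩, by
    rintro ⟨_, a, rfl⟩
    exact Subtype.ext (congrArg E (hRE a))⟩

/-- The quotient of a split exact sequence. -/
def quotientEquivOfSplit (hQJ : ∀ c, Q (J c) = c) (hQE : ∀ a, Q (E a) = 0)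
    (hsum : ∀ b, E (R b) + J (Q b) = b) : (B ⧸ LinearMap.range (E : A →ₗ[ℂ] B)) ≃L[ℂ] C :=
  ContinuousLinearEquiv.equivOfInverse
    ((LinearMap.range (E : A →ₗ[ℂ] B)).liftQL Q (range_eq_ker_of_split hQE hsum).le)
    ((LinearMap.range (E : A →ₗ[ℂ] B)).mkQL.comp J)
    (by
      intro x
      obtain ⟨b, rfl⟩ := Submodule.Quotient.mk_surjective _ x
      refine (Submodule.Quotient.eq _).2 ⟨-R b, ?_⟩
      change E (-R b) = J (Q b) - b
      rw [map_neg]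
      nth_rw 3 [← hsum b]
      abel)
    hQJ

/-- The middle term of a split exact sequence is the direct sum of the other two. -/
def prodEquivOfSplit (hRE : ∀ a, R (E a) = a) (hQJ : ∀ c, Q (J c) = c) (hQE : ∀ a, Q (E a) = 0)
    (hRJ : ∀ c, R (J c) = 0) (hsum : ∀ b, E (R b) + J (Q b) = b) : B ≃L[ℂ] (A × C) :=
  ContinuousLinearEquiv.equivOfInverse (R.prod Q) (E.coprod J) hsum (by
    rintro ⟨a, c⟩
    simp [hRE, hQJ, hQE, hRJ])

end SplitSequence

end

/-! ### The splitting on U. -/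

theorem mainTheorem9 {S : Type u} [NormedAddCommGroup S] [NormedSpace ℂ S] [CompleteSpace S]
    {U : TopologicalSpace.Opens ℂ} (F : AnalyticSpace.{v, u} U S) (hF : F.IsAcceptable)
    (ψ : ConformalEquiv unitDisc U) (m : ℕ) (hm : 1 ≤ m) (z : U) :
    -- the arrays `τ_{(m,0]} f`, with `f ∈ F`, are elements of `𝒯` with the same norm
    (∀ f : F.carrier, ∃ H : (F.rochbergFamily ψ m).carrier,
      (∀ u : U, (F.rochbergFamily ψ m).toFun H u = F.jet m u f) ∧ ‖H‖ = ‖f‖) ∧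
    -- the natural map sends `τ_{(m+1,0]} f (z)` to `τ_{(2,0]} (τ_{(m,0]} f) (z)`
    ∃ E : F.Rochberg (m + 1) z →L[ℂ] (F.rochbergFamily ψ m).Rochberg 2 z,
      (∀ (f : F.carrier) (H : (F.rochbergFamily ψ m).carrier),
        (∀ u : U, (F.rochbergFamily ψ m).toFun H u = F.jet m u f) →
          E (AnalyticSpace.Rochberg.mk F (m + 1) z f) = AnalyticSpace.Rochberg.mk (F.rochbergFamily ψ m) 2 z H) ∧
      (∀ (x : F.Rochberg (m + 1) z) (i : Fin 2) (j : Fin m),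
        AnalyticSpace.Rochberg.val (F.rochbergFamily ψ m) 2 z (E x) i j =
          (((i : ℕ) + (j : ℕ)).choose (i : ℕ) : ℂ) •
            AnalyticSpace.Rochberg.val F (m + 1) z x ⟨(i : ℕ) + (j : ℕ), by omega⟩) ∧
      Topology.IsClosedEmbedding E ∧
      (LinearMap.range (E : F.Rochberg (m + 1) z →ₗ[ℂ]
        (F.rochbergFamily ψ m).Rochberg 2 z)).ClosedComplemented ∧
      Nonempty (((F.rochbergFamily ψ m).Rochberg 2 z ⧸ LinearMap.range
        (E : F.Rochberg (m + 1) z →ₗ[ℂ] (F.rochbergFamily ψ m).Rochberg 2 z)) ≃L[ℂ]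
          F.Rochberg (m - 1) z) ∧
      Nonempty ((F.rochbergFamily ψ m).Rochberg 2 z ≃L[ℂ]
        (F.Rochberg (m + 1) z × F.Rochberg (m - 1) z)) := by
  have hw : ψ.invFun z ∈ unitDisc := ψ.inv_mem z z.2
  obtain ⟨w, hwz⟩ : ∃ w : unitDisc, ψ.invFun z = w := ⟨⟨_, hw⟩, rfl⟩
  -- Multiplication by ψ⁻¹(u) - w on F is multiplication by x - w after the change of variable.
  obtain ⟨M, hM'⟩ := hF.exists_mul ψ.symm w
  have hM : ∀ f : (F.pullback ψ).carrier, ∀ x ∈ unitDisc, (F.pullback ψ).toFun (M f) x =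
      (x - w) • (F.pullback ψ).toFun f x := fun f x hx => by
    have h := hM' f _ (ψ.map_mem x hx)
    rwa [show ψ.symm.toFun (ψ.toFun x) = x from ψ.left_inv x hx] at h
  -- F and its pullback share their carrier and norm by definition, as do 𝒯 and 𝒢^{(m)}, so the
  -- operators built on the disc act directly on the spaces over U.
  let e : F.carrier →L[ℂ] (F.rochbergFamily ψ m).carrier := (F.pullback ψ).single m 0
  let r : (F.rochbergFamily ψ m).carrier →L[ℂ] F.carrier := (F.pullback ψ).retraction m M
  let q : (F.rochbergFamily ψ m).carrier →L[ℂ] F.carrier := (F.pullback ψ).defect m M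
  let j : F.carrier →L[ℂ] (F.rochbergFamily ψ m).carrier := (F.pullback ψ).defectSection m M
  have hp := fun (n : ℕ) (f : F.carrier) => F.mk_pullback_eq_zero_iff ψ n hwz f
  have ht := fun p => F.mk_rochbergFamily_eq_zero_iff ψ m 2 hwz p
  have he : ∀ f, AnalyticSpace.Rochberg.mk F (m + 1) z f = 0 →
      AnalyticSpace.Rochberg.mk (F.rochbergFamily ψ m) 2 z (e f) = 0 := fun f hf =>
    (ht _).2 (AnalyticSpace.mk_single_eq_zero (X := F.pullback ψ) (w := w) hm f ((hp _ f).2 hf))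
  have hr : ∀ p, AnalyticSpace.Rochberg.mk (F.rochbergFamily ψ m) 2 z p = 0 →
      AnalyticSpace.Rochberg.mk F (m + 1) z (r p) = 0 := fun p h =>
    (hp _ _).1 (AnalyticSpace.mk_retraction_eq_zero (X := F.pullback ψ) (w := w) hM hm p ((ht p).1 h))
  have hq : ∀ p, AnalyticSpace.Rochberg.mk (F.rochbergFamily ψ m) 2 z p = 0 →
      AnalyticSpace.Rochberg.mk F (m - 1) z (q p) = 0 := fun p h =>
    (hp _ _).1 (AnalyticSpace.mk_defect_eq_zero (X := F.pullback ψ) (w := w) hM p ((ht p).1 h))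
  have hj : ∀ f, AnalyticSpace.Rochberg.mk F (m - 1) z f = 0 →
      AnalyticSpace.Rochberg.mk (F.rochbergFamily ψ m) 2 z (j f) = 0 := fun f hf =>
    (ht _).2 (AnalyticSpace.mk_defectSection_eq_zero (X := F.pullback ψ) (w := w) hM hm f ((hp _ f).2 hf))
  have hRE : ∀ x, AnalyticSpace.Rochberg.map r hr (AnalyticSpace.Rochberg.map e he x) = x := by
    intro x
    obtain ⟨f, rfl⟩ := AnalyticSpace.Rochberg.mk_surjective F (m + 1) z x
    rw [AnalyticSpace.Rochberg.map_mk, AnalyticSpace.Rochberg.map_mk]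
    exact congrArg _ (AnalyticSpace.retraction_single (X := F.pullback ψ) hm f)
  have hQE : ∀ x, AnalyticSpace.Rochberg.map q hq (AnalyticSpace.Rochberg.map e he x) = 0 := by
    intro x
    obtain ⟨f, rfl⟩ := AnalyticSpace.Rochberg.mk_surjective F (m + 1) z x
    rw [AnalyticSpace.Rochberg.map_mk, AnalyticSpace.Rochberg.map_mk,
      show q (e f) = 0 from AnalyticSpace.defect_single (X := F.pullback ψ) f, map_zero]
  have hQJ : ∀ x, AnalyticSpace.Rochberg.map q hq (AnalyticSpace.Rochberg.map j hj x) = x := by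
    intro x
    obtain ⟨f, rfl⟩ := AnalyticSpace.Rochberg.mk_surjective F (m - 1) z x
    rw [AnalyticSpace.Rochberg.map_mk, AnalyticSpace.Rochberg.map_mk, ← sub_eq_zero, ← map_sub]
    refine (hp _ _).1 ?_
    exact (map_sub (AnalyticSpace.Rochberg.mk (F.pullback ψ) (m - 1) w) _ _).trans (sub_eq_zero.2
      (AnalyticSpace.mk_defect_defectSection (X := F.pullback ψ) (M := M) f))
  have hRJ : ∀ x, AnalyticSpace.Rochberg.map r hr (AnalyticSpace.Rochberg.map j hj x) = 0 := by
    intro x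
    obtain ⟨f, rfl⟩ := AnalyticSpace.Rochberg.mk_surjective F (m - 1) z x
    rw [AnalyticSpace.Rochberg.map_mk, AnalyticSpace.Rochberg.map_mk,
      show r (j f) = 0 from AnalyticSpace.retraction_defectSection (X := F.pullback ψ) hm f,
      map_zero]
  have hsum : ∀ x, AnalyticSpace.Rochberg.map e he (AnalyticSpace.Rochberg.map r hr x) +
      AnalyticSpace.Rochberg.map j hj (AnalyticSpace.Rochberg.map q hq x) = x := by
    intro x
    obtain ⟨p, rfl⟩ := AnalyticSpace.Rochberg.mk_surjective (F.rochbergFamily ψ m) 2 z x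
    simp only [AnalyticSpace.Rochberg.map_mk]
    rw [← sub_eq_zero, ← map_add, ← map_sub]
    exact (ht _).2 (AnalyticSpace.mk_single_retraction_add (X := F.pullback ψ) hM hm p)
  have hval : ∀ (f : F.carrier) (u : U), (F.rochbergFamily ψ m).toFun (e f) u = F.jet m u f :=
    fun f u => F.rochbergFamily_single ψ m hm f u
  refine ⟨fun f => ⟨e f, hval f, AnalyticSpace.norm_single_zero (F.pullback ψ) hm f⟩,
    AnalyticSpace.Rochberg.map e he, fun f H hH => ?_, fun x i k => ?_,
    isClosedEmbedding_of_split (hF.isClosed_singleton_zero (m - 1) z) hRE hQE hsum,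
    closedComplemented_of_leftInverse hRE, ⟨quotientEquivOfSplit hQJ hQE hsum⟩,
    ⟨prodEquivOfSplit hRE hQJ hQE hRJ hsum⟩⟩
  · rw [AnalyticSpace.Rochberg.map_mk]
    congr 1
    exact (F.rochbergFamily ψ m).injective _ _ fun u hu => by
      rw [hval f ⟨u, hu⟩, hH ⟨u, hu⟩]
  · obtain ⟨f, rfl⟩ := AnalyticSpace.Rochberg.mk_surjective F (m + 1) z x
    rw [AnalyticSpace.Rochberg.map_mk]
    exact F.rochbergFamily_jet_single ψ m 2 hm f z i k
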